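/- Let $k$ be a field of characteristic $p>0$, $\bar k$ an algebraic closure of $k$, $\ell\neq p$ a prime, and $\Lambda_n=\mathbb Z/\ell^n\mathbb Z$. For a $\Lambda_n$-module $V$ with $n\ge 1$ put $V^*=\{v\in V:\ell^{n-1}v\neq 0\}$ and $P_n(V)=V^*/\Lambda_n^*$. Let $U$ be a smooth curve over $k$ (a separated $k$-scheme of finite type, smooth of relative dimension $1$), and let $\mathcal V_\bullet=(\mathcal V_n)_{n\ge 1}$ be a projective system of sheaves on the small étale site of $U$, where $\mathcal V_n$ is a locally constant sheaf of free $\Lambda_n$-modules of rank $b$, with $b$ independent of $n$. Assume that the kernel of each transition morphism $\varphi_n:\mathcal V_{n+1}\to\mathcal V_n$ is killed by $\ell$ (equivalently, $\varphi_n$ induces an isomorphism $\mathcal V_{n+1}/\ell^n\mathcal V_{n+1}\cong\mathcal V_n$). Let $\mathcal V_n^*\subset\mathcal V_n$ be the subsheaf of sections $v$ such that $\ell^{n-1}v$ does not vanish on any nonempty étale $U$-scheme over which $v$ is defined, and let $P_n(\mathcal V_n)$ be the quotient sheaf $\mathcal V_n^*/\Lambda_n^*$. Let $U_n$ be an étale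 $U$-scheme that represents $P_n(\mathcal V_n)$. Let $C_0$ be a regular projective $k$-scheme that contains $U$ as a dense open subscheme (for instance a smooth projectivisation of $U$), and for $n\ge 1$ let $C_n$ be a regular projective $k$-scheme that contains $U_n$ as a dense open subscheme. Then the following hold. (1) For every $n\ge1$ the structure morphism $U_n\to U$ extends uniquely to a morphism $C_n\to C_0$, and the morphism $U_{n+1}\to U_n$ that represents the morphism $P_{n+1}(\mathcal V_{n+1})\to P_n(\mathcal V_n)$, $[v]\mapsto[\varphi_n(v)]$, extends uniquely to a morphism $C_{n+1}\to C_n$. (2) For every $n\ge 1$ and $\bar a\in U(\bar k)$ there is a bijection from $P_n((\mathcal V_n)_{\bar a})$ to the set of $\bar k$-points of $C_n$ over $\bar a$. It is natural in the following sense: if $t$ is a lift of $\bar a$ to an étale $U$-scheme $T$ and $v\in\mathcal V_n^*(T)$, then the class of the germ $v_t$ is sent to the image of $t$ under the $U$-morphism $T\to U_n\subset C_n$ that corresponds to $[v]\in P_n(\mathcal V_n)(T)$. This bijection identifies the geometric fiber $C_n\times_{C_0}\bar a$ with the disjoint union of copies of $\operatorname{Spec}\bar k$ indexed by $P_n((\mathcal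 V_n)_{\bar a})$. (3) The morphism $C_1\to C_0$ is finite and locally free of constant degree $(\ell^b-1)/(\ell-1)$. (4) For every $n>1$ the morphism $C_n\to C_{n-1}$ is finite and locally free of constant degree $\ell^{b-1}$. (If $b=0$, all $C_n$ with $n\ge 1$ are empty and this is an empty assertion.) -/

import Mathlib

open CategoryTheory AlgebraicGeometry Opposite Limits

universe u

/-! ### Projectivisation of a module over `ℤ/ℓⁿ` -/

/-- `V^* = {v ∈ V | ℓ^(n-1) v ≠ 0}` for a `ℤ/ℓⁿ`-module `V` (used for `n ≥ 1` only). -/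
def ModStar (ℓ n : ℕ) (M : Type*) [AddCommGroup M] : Type _ :=
  {v : M // ℓ ^ (n - 1) • v ≠ 0}

theorem nsmul_units_smul_ne_zero {R M : Type*} [Ring R] [AddCommGroup M] [Module R M]
    (m : ℕ) (c : Rˣ) {v : M} (hv : m • v ≠ 0) : m • (c • v) ≠ 0 := by
  intro h
  rw [smul_comm] at h
  exact hv ((smul_eq_zero_iff_eq c).mp h)

/-- The action of `(ℤ/ℓⁿ)ˣ` on `V^*`. -/
instance ModStar.instMulAction (ℓ n : ℕ) (M : Type*) [AddCommGroup M] [Module (ZMod (ℓ ^ n)) M] :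
    MulAction (ZMod (ℓ ^ n))ˣ (ModStar ℓ n M) where
  smul c v := ⟨c • v.1, nsmul_units_smul_ne_zero _ c v.2⟩
  one_smul v := Subtype.ext (one_smul _ v.1)
  mul_smul c d v := Subtype.ext (mul_smul c d v.1)

/-- The projectivisation `P_n(V) = V^* / (ℤ/ℓⁿ)ˣ` of a `ℤ/ℓⁿ`-module `V`. -/
def ModProj (ℓ n : ℕ) (M : Type*) [AddCommGroup M] [Module (ZMod (ℓ ^ n)) M] : Type _ :=
  MulAction.orbitRel.Quotient (ZMod (ℓ ^ n))ˣ (ModStar ℓ n M)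

/-- The class of `v ∈ V^*` in `P_n(V)`. -/
def ModProj.mk {ℓ n : ℕ} {M : Type*} [AddCommGroup M] [Module (ZMod (ℓ ^ n)) M]
    (v : ModStar ℓ n M) : ModProj ℓ n M :=
  Quotient.mk (MulAction.orbitRel (ZMod (ℓ ^ n))ˣ (ModStar ℓ n M)) v

/-! ### Projectivisation of a sheaf of `ℤ/ℓⁿ`-modules on the small étale site -/

section Sheaves

variable {U : Scheme.{u}} {ℓ n : ℕ}

/-- Sections of `𝒱^*` over `T`: those `v ∈ 𝒱(T)` such that `ℓ^(n-1) v` does not vanish on any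
nonempty étale `T'` over `T`. For connected `T` and locally constant `𝒱` this is `𝒱(T)^*`; the
condition on `T'` makes it a sheaf, whose stalks are the sets `(𝒱_a)^*`. -/
def StarSections (F : U.Etaleᵒᵖ ⥤ ModuleCat.{u} (ZMod (ℓ ^ n))) (T : U.Etale) : Type u :=
  {v : F.obj (op T) // ∀ ⦃T' : U.Etale⦄ (f : T' ⟶ T), Nonempty T'.left →
    ℓ ^ (n - 1) • F.map f.op v ≠ 0}

/-- The action of `(ℤ/ℓⁿ)ˣ` on the sections of `𝒱^*`. -/
instance StarSections.instMulAction (F : U.Etaleᵒᵖ ⥤ ModuleCat.{u} (ZMod (ℓ ^ n))) (T : U.Etale) :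
    MulAction (ZMod (ℓ ^ n))ˣ (StarSections F T) where
  smul c v := ⟨c • v.1, fun T' f hT' ↦ by
    have h : F.map f.op (c • v.1) = c • F.map f.op v.1 :=
      map_smul (F.map f.op).hom (c : ZMod (ℓ ^ n)) v.1
    rw [h]
    exact nsmul_units_smul_ne_zero _ c (v.2 f hT')⟩
  one_smul v := Subtype.ext (one_smul _ v.1)
  mul_smul c d v := Subtype.ext (mul_smul c d v.1)

/-- Restriction of sections of `𝒱^*`. -/
def StarSections.res (F : U.Etaleᵒᵖ ⥤ ModuleCat.{u} (ZMod (ℓ ^ n))) {T T' : U.Etale}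
    (f : T' ⟶ T) (v : StarSections F T) : StarSections F T' :=
  ⟨F.map f.op v.1, fun T'' g h ↦ by
    have := v.2 (g ≫ f) h
    simpa using this⟩

theorem StarSections.res_smul (F : U.Etaleᵒᵖ ⥤ ModuleCat.{u} (ZMod (ℓ ^ n))) {T T' : U.Etale}
    (f : T' ⟶ T) (c : (ZMod (ℓ ^ n))ˣ) (v : StarSections F T) :
    StarSections.res F f (c • v) = c • StarSections.res F f v :=
  Subtype.ext (map_smul (F.map f.op).hom (c : ZMod (ℓ ^ n)) v.1)

/-- The presheaf `T ↦ 𝒱^*(T) / (ℤ/ℓⁿ)ˣ`. -/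
def projPresheaf (F : U.Etaleᵒᵖ ⥤ ModuleCat.{u} (ZMod (ℓ ^ n))) : U.Etaleᵒᵖ ⥤ Type u where
  obj T := MulAction.orbitRel.Quotient (ZMod (ℓ ^ n))ˣ (StarSections F T.unop)
  map f := ↾(Quotient.map (StarSections.res F f.unop) (by
    rintro _ v ⟨c, rfl⟩
    exact ⟨c, (StarSections.res_smul F f.unop c v).symm⟩))
  map_id T := by
    ext x
    induction x using Quotient.inductionOn with | _ v =>
    exact congrArg (Quotient.mk _) (Subtype.ext (by simp [StarSections.res]))
  map_comp f g := by
    ext x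
    induction x using Quotient.inductionOn with | _ v =>
    exact congrArg (Quotient.mk _) (Subtype.ext (by simp [StarSections.res]))

/-- The sheaf `P_n(𝒱)`: the quotient of the sheaf `𝒱^*` by `(ℤ/ℓⁿ)ˣ`. -/
noncomputable def projSheaf (F : Sheaf U.smallEtaleTopology (ModuleCat.{u} (ZMod (ℓ ^ n)))) :
    Sheaf U.smallEtaleTopology (Type u) :=
  (presheafToSheaf U.smallEtaleTopology (Type u)).obj (projPresheaf F.obj)

/-- The section of `P_n(𝒱)` over `T` given by a section of `𝒱^*` over `T`. -/
noncomputable def projClass (F : Sheaf U.smallEtaleTopology (ModuleCat.{u} (ZMod (ℓ ^ n))))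
    {T : U.Etale} (v : StarSections F.obj T) : (projSheaf F).obj.obj (op T) :=
  (toSheafify U.smallEtaleTopology (projPresheaf F.obj)).app (op T)
    (Quotient.mk (MulAction.orbitRel (ZMod (ℓ ^ n))ˣ (StarSections F.obj T)) v)

/-- `F` is locally isomorphic to the constant sheaf `(ℤ/ℓⁿ)ᵇ`: on the members `T` of an étale
covering of `U`, there is a locally bijective morphism from the constant presheaf `(ℤ/ℓⁿ)ᵇ` to
`F|_T`, which exhibits `F|_T` as the constant sheaf. -/
def IsLocallyConstantFree (b : ℕ)
    (F : Sheaf U.smallEtaleTopology (ModuleCat.{u} (ZMod (ℓ ^ n)))) : Prop :=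
  ∃ S ∈ U.smallEtaleTopology (Scheme.Etale.mk (𝟙 U)),
    ∀ ⦃T : U.Etale⦄ (f : T ⟶ Scheme.Etale.mk (𝟙 U)), S f →
      ∃ α : (Functor.const (Over T)ᵒᵖ).obj
          (ModuleCat.of (ZMod (ℓ ^ n)) (ULift.{u} (Fin b → ZMod (ℓ ^ n)))) ⟶ (F.over T).obj,
        Presheaf.IsLocallyInjective (U.smallEtaleTopology.over T) α ∧
        Presheaf.IsLocallySurjective (U.smallEtaleTopology.over T) α

/-! ### The morphism induced on projectivisations -/

/-- Homomorphisms of sheaves of abelian groups from a sheaf of `ℤ/ℓᵐ`-modules to a sheaf of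
`ℤ/ℓⁿ`-modules; for `n ≤ m` they are automatically `ℤ/ℓᵐ`-linear. -/
abbrev AbHom {m n : ℕ} (F : Sheaf U.smallEtaleTopology (ModuleCat.{u} (ZMod (ℓ ^ m))))
    (G : Sheaf U.smallEtaleTopology (ModuleCat.{u} (ZMod (ℓ ^ n)))) : Type (u + 1) :=
  F.obj ⋙ forget₂ (ModuleCat.{u} (ZMod (ℓ ^ m))) Ab.{u} ⟶
    G.obj ⋙ forget₂ (ModuleCat.{u} (ZMod (ℓ ^ n))) Ab.{u}

/-- The additive map on sections over `T`. -/
def AbHom.onSections {m n : ℕ} {F : Sheaf U.smallEtaleTopology (ModuleCat.{u} (ZMod (ℓ ^ m)))}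
    {G : Sheaf U.smallEtaleTopology (ModuleCat.{u} (ZMod (ℓ ^ n)))} (φ : AbHom F G) (T : U.Etale) :
    F.obj.obj (op T) →+ G.obj.obj (op T) :=
  (φ.app (op T)).hom

/-- `ℓ · ker φ = 0`. -/
def AbHom.KerKilled {m n : ℕ} {F : Sheaf U.smallEtaleTopology (ModuleCat.{u} (ZMod (ℓ ^ m)))}
    {G : Sheaf U.smallEtaleTopology (ModuleCat.{u} (ZMod (ℓ ^ n)))} (φ : AbHom F G) : Prop :=
  ∀ (T : U.Etale) (v : F.obj.obj (op T)), φ.onSections T v = 0 → ℓ • v = 0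

theorem AbHom.naturality_apply {m n : ℕ}
    {F : Sheaf U.smallEtaleTopology (ModuleCat.{u} (ZMod (ℓ ^ m)))}
    {G : Sheaf U.smallEtaleTopology (ModuleCat.{u} (ZMod (ℓ ^ n)))} (φ : AbHom F G)
    {T T' : U.Etale} (f : T' ⟶ T) (v : F.obj.obj (op T)) :
    φ.onSections T' (F.obj.map f.op v) = G.obj.map f.op (φ.onSections T v) :=
  ConcreteCategory.congr_hom (φ.naturality f.op) v

/-- The map `𝒱_{n+1}^* → 𝒱_n^*` on sections. -/
def StarSections.map {m n : ℕ} {F : Sheaf U.smallEtaleTopology (ModuleCat.{u} (ZMod (ℓ ^ m)))}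
    {G : Sheaf U.smallEtaleTopology (ModuleCat.{u} (ZMod (ℓ ^ n)))} (φ : AbHom F G)
    (hφ : φ.KerKilled) (hn : 1 ≤ n) (hm : m = n + 1) {T : U.Etale} (v : StarSections F.obj T) :
    StarSections G.obj T :=
  ⟨φ.onSections T v.1, fun T' f hT' h ↦ v.2 f hT' (by
    rw [← φ.naturality_apply, ← map_nsmul] at h
    have := hφ T' _ h
    rwa [smul_smul, ← pow_succ', show n - 1 + 1 = m - 1 by omega] at this)⟩

/-- The morphism of presheaves `𝒱_{n+1}^*/(ℤ/ℓⁿ⁺¹)ˣ → 𝒱_n^*/(ℤ/ℓⁿ)ˣ` given by `[v] ↦ [φ(v)]`. -/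
def projPresheafMap {m n : ℕ} {F : Sheaf U.smallEtaleTopology (ModuleCat.{u} (ZMod (ℓ ^ m)))}
    {G : Sheaf U.smallEtaleTopology (ModuleCat.{u} (ZMod (ℓ ^ n)))} (φ : AbHom F G)
    (hφ : φ.KerKilled) (hn : 1 ≤ n) (hm : m = n + 1) :
    projPresheaf F.obj ⟶ projPresheaf G.obj where
  app T := ↾(Quotient.map (StarSections.map φ hφ hn hm) (by
    rintro _ v ⟨c, rfl⟩
    have hd : ℓ ^ n ∣ ℓ ^ m := pow_dvd_pow _ (by omega)
    refine ⟨Units.map (ZMod.castHom hd (ZMod (ℓ ^ n))).toMonoidHom c, Subtype.ext ?_⟩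
    obtain ⟨z, hz⟩ := ZMod.intCast_surjective (c : ZMod (ℓ ^ m))
    change (ZMod.castHom hd (ZMod (ℓ ^ n)) (c : ZMod (ℓ ^ m))) • φ.onSections T.unop v.1 =
      φ.onSections T.unop ((c : ZMod (ℓ ^ m)) • v.1)
    rw [← hz, map_intCast, Int.cast_smul_eq_zsmul, Int.cast_smul_eq_zsmul, map_zsmul]))
  naturality T T' f := by
    ext x
    induction x using Quotient.inductionOn with | _ v =>
    exact congrArg (Quotient.mk _) (Subtype.ext (φ.naturality_apply f.unop v.1))

/-- The morphism of sheaves `P_{n+1}(𝒱_{n+1}) → P_n(𝒱_n)` induced by `φ`. -/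
noncomputable def projSheafMap {m n : ℕ}
    {F : Sheaf U.smallEtaleTopology (ModuleCat.{u} (ZMod (ℓ ^ m)))}
    {G : Sheaf U.smallEtaleTopology (ModuleCat.{u} (ZMod (ℓ ^ n)))} (φ : AbHom F G)
    (hφ : φ.KerKilled) (hn : 1 ≤ n) (hm : m = n + 1) : projSheaf F ⟶ projSheaf G :=
  (presheafToSheaf U.smallEtaleTopology (Type u)).map (projPresheafMap φ hφ hn hm)

/-- The morphism of representing schemes that corresponds to a morphism of sheaves. -/
def representedMap {P Q : Sheaf U.smallEtaleTopology (Type u)} {X Y : U.Etale}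
    (hX : P.obj.RepresentableBy X) (hY : Q.obj.RepresentableBy Y) (ψ : P ⟶ Q) : X ⟶ Y :=
  hY.homEquiv.symm (ψ.hom.app (op X) (hX.homEquiv (𝟙 X)))

/-! ### Germs -/

instance ModuleCat.preservesFilteredColimits_forget_zmod (q : ℕ) :
    PreservesFilteredColimitsOfSize.{u, u} (forget (ModuleCat.{u} (ZMod q))) :=
  have : PreservesFilteredColimitsOfSize.{u, u} (forget₂ (ModuleCat.{u} (ZMod q)) Ab.{u}) :=
    ⟨fun _ ↦ inferInstance⟩
  inferInstanceAs (PreservesFilteredColimitsOfSize.{u, u}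
    (forget₂ (ModuleCat.{u} (ZMod q)) Ab.{u} ⋙ forget Ab.{u}))

/-- The stalk of a sheaf on the small étale site at a geometric point. -/
noncomputable abbrev etaleStalk {K : Type u} [Field K] [IsSepClosed K]
    (F : Sheaf U.smallEtaleTopology (ModuleCat.{u} (ZMod (ℓ ^ n)))) (a : Spec (.of K) ⟶ U) :
    ModuleCat.{u} (ZMod (ℓ ^ n)) :=
  (Scheme.pointSmallEtale a).sheafFiber.obj F

/-- The germ at `a` of a section of `𝒱^*` over an étale neighbourhood `(T, t)` of `a`, as an element
of `(𝒱_a)^*`. -/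
noncomputable def StarSections.germ {K : Type u} [Field K] [IsSepClosed K]
    {F : Sheaf U.smallEtaleTopology (ModuleCat.{u} (ZMod (ℓ ^ n)))} {a : Spec (.of K) ⟶ U}
    {T : U.Etale} (t : (Scheme.pointSmallEtale a).fiber.obj T) (v : StarSections F.obj T) :
    ModStar ℓ n (etaleStalk F a) :=
  ⟨(Scheme.pointSmallEtale a).toPresheafFiber T t F.obj v.1, fun h ↦ by
    have h' : (Scheme.pointSmallEtale a).toPresheafFiber T t F.obj (ℓ ^ (n - 1) • v.1) =
        (Scheme.pointSmallEtale a).toPresheafFiber T t F.obj 0 := by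
      exact ((map_nsmul ((Scheme.pointSmallEtale a).toPresheafFiber T t F.obj).hom _ _).trans
        h).trans (map_zero ((Scheme.pointSmallEtale a).toPresheafFiber T t F.obj).hom).symm
    rw [GrothendieckTopology.Point.toPresheafFiber_eq_iff'] at h'
    obtain ⟨Y, f, y, -, hy⟩ := h'
    exact v.2 f ⟨y.left (default : Spec (.of K))⟩
      (((map_nsmul (F.obj.map f.op).hom _ _).symm.trans hy).trans
        (map_zero (F.obj.map f.op).hom))⟩

end Sheaves

/-! ### The data of the construction -/

/-- A projective system `𝒱_•` of locally constant sheaves of free `ℤ/ℓⁿ`-modules of constant rank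
`b` on the small étale site of `U`, indexed by `n ≥ 1`. The condition `ℓ · ker = 0` says that
`𝒱_{n+1} → 𝒱_n` is the natural projection: as both sheaves are locally free of rank `b`, it holds if
and only if the morphism induces an isomorphism `𝒱_{n+1} / ℓⁿ 𝒱_{n+1} ≅ 𝒱_n`. -/
structure ProjSystem (U : Scheme.{u}) (ℓ b : ℕ) where
  /-- the sheaf `𝒱_n` -/
  V (n : ℕ+) : Sheaf U.smallEtaleTopology (ModuleCat.{u} (ZMod (ℓ ^ (n : ℕ))))
  locallyConstantFree (n : ℕ+) : IsLocallyConstantFree b (V n)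
  /-- the transition morphism `𝒱_{n+1} → 𝒱_n` -/
  φ (n : ℕ+) : AbHom (V (n + 1)) (V n)
  kerKilled (n : ℕ+) : (φ n).KerKilled

/-- A regular compactification of a scheme `X` over a field `k`: a proper `k`-scheme all of whose
local rings are regular, with a dense open immersion of `X` over `k`. (In dimension one, proper is
the same as projective.) -/
structure RegularCompactification {k : Type u} [Field k] {X : Scheme.{u}}
    (s : X ⟶ Spec (.of k)) where
  /-- the compactification -/
  C : Scheme.{u}
  /-- its structure morphism -/
  str : C ⟶ Spec (.of k)
  /-- the inclusion of `X` -/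
  ι : X ⟶ C
  ι_str : ι ≫ str = s
  isOpenImmersion : IsOpenImmersion ι
  isDominant : IsDominant ι
  isProper : IsProper str
  isRegular (x : C) : IsRegularLocalRing (C.presheaf.stalk x)

/-- A morphism of schemes is finite locally free of degree `d` if it is finite and flat, and has
rank `d` at each point of the target. -/
structure IsFiniteOfDegree {X Y : Scheme.{u}} (f : X ⟶ Y) (d : ℚ) : Prop where
  isFinite : IsFinite f
  flat : Flat f
  finrank_eq (y : Y) : (f.finrank y : ℚ) = d

/-! ### Regular local rings of dimension at most one -/

/-! Over an étale cover that trivialises `𝒱_n`, the sheaf `P_n(𝒱_n)` is constant with finite value.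
A geometric point of `U_n` over `a` is the class of a germ, so the geometric fibre of `U_n` over `a`
is `P_n` of the stalk (`IsLocallyConstantFree.exists_equiv_fiber`). Such a class extends to a
section of `U_n` over the whole trivialising neighbourhood, which gives universal closedness and
then finiteness of `U_n → U` (`IsLocallyConstantFree.isFinite`).

The rest is geometry of curves. Density of `U_n` forces the regular local rings of `C_n` to have
dimension at most one (`ringKrullDim_stalk_le_one`), so they are fields or discrete valuation rings.
The valuative criterion extends morphisms of the open curves to the compactifications
(`exists_extension`); density, reducedness and separatedness make the extension unique. As the
morphism of open curves is proper, its source is the whole preimage of its target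
(`isPullback_of_isProper`), so the fibres over points of `U` do not change. The boundary is a finite
set, so the extension is proper with finite fibres, hence finite (`isFinite_of_isProper`). It is
flat because its local rings are torsion-free over principal ideal domains (`flat_of_isOpenMap`).
Its degree is locally constant, so it can be read off on the dense open part, where it counts
geometric points.

The count uses that `(ℤ/ℓⁿ)ˣ` acts freely on `V^*`. For `n = 1` this gives `(ℓ^b - 1)/(ℓ - 1)`. The
transition maps are surjective on stalks with kernel of order `ℓ^b`, so a fibre of `P_{n+1} → P_n`
has `ℓ^b |(ℤ/ℓⁿ)ˣ| / |(ℤ/ℓⁿ⁺¹)ˣ| = ℓ^(b-1)` elements (`ModProj.natCard_fiber_map`). -/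

theorem IsRegularLocalRing.isPrincipal_maximalIdeal {R : Type*} [CommRing R] [IsRegularLocalRing R]
    (h : ringKrullDim R ≤ 1) : (IsLocalRing.maximalIdeal R).IsPrincipal := by
  have h1 : (IsLocalRing.maximalIdeal R).spanFinrank ≤ 1 := by
    have := IsRegularLocalRing.spanFinrank_maximalIdeal (R := R)
    rw [← this] at h
    exact_mod_cast h
  have hfg := (isNoetherianRing_iff_ideal_fg R).mp inferInstance (IsLocalRing.maximalIdeal R)
  rcases Nat.le_one_iff_eq_zero_or_eq_one.mp h1 with h0 | h0
  · rw [(Submodule.spanFinrank_eq_zero_iff_eq_bot hfg).mp h0]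
    infer_instance
  · exact ((Submodule.spanFinrank_eq_one_iff _).mp h0).1

/-- A prime `q` other than the maximal ideal `𝔪 = (π)` does not contain `π`, so `q = πq` and
Nakayama gives `q = 0`. If there is no such prime, the dimension is zero, and regularity gives `𝔪 =
0`. -/
theorem IsRegularLocalRing.isDomain_of_ringKrullDim_le_one {R : Type*} [CommRing R]
    [IsRegularLocalRing R] (h : ringKrullDim R ≤ 1) : IsDomain R := by
  have hfg := (isNoetherianRing_iff_ideal_fg R).mp inferInstance
  by_cases hq : ∃ q : Ideal R, q.IsPrime ∧ q ≠ IsLocalRing.maximalIdeal R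
  · obtain ⟨q, hq, hqm⟩ := hq
    obtain ⟨π, hπ⟩ := (IsRegularLocalRing.isPrincipal_maximalIdeal h).principal
    have hle : q ≤ Ideal.span {π} := (IsLocalRing.le_maximalIdeal hq.ne_top).trans hπ.le
    have hπq : π ∉ q := fun hmem ↦ hqm (le_antisymm (IsLocalRing.le_maximalIdeal hq.ne_top)
      (hπ ▸ (Ideal.span_singleton_le_iff_mem q).mpr hmem))
    have hq0 : q = ⊥ := by
      refine Submodule.eq_bot_of_le_smul_of_le_jacobson_bot (IsLocalRing.maximalIdeal R) q (hfg q)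
        (fun x hx ↦ ?_) (IsLocalRing.maximalIdeal_le_jacobson _)
      obtain ⟨y, rfl⟩ := Ideal.mem_span_singleton'.mp (hle hx)
      rw [mul_comm]
      refine Submodule.smul_mem_smul (hπ ▸ Ideal.mem_span_singleton_self π) ?_
      exact (hq.mem_or_mem hx).resolve_right hπq
    subst hq0
    exact IsDomain.of_bot_isPrime R
  · push Not at hq
    have : Ring.KrullDimLE 0 R := Ring.krullDimLE_zero_iff.mpr fun I hI ↦ by
      rw [hq I hI]; infer_instance
    have h0 := (ringKrullDimZero_iff_ringKrullDim_eq_zero (R := R)).mp this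
    have h1 := IsRegularLocalRing.spanFinrank_maximalIdeal (R := R)
    rw [h0] at h1
    have h2 := (Submodule.spanFinrank_eq_zero_iff_eq_bot (hfg _)).mp (by exact_mod_cast h1)
    have := (IsLocalRing.isField_iff_maximalIdeal_eq (R := R)).mpr h2
    exact this.isDomain

theorem IsRegularLocalRing.isPrincipalIdealRing_of_ringKrullDim_le_one {R : Type*} [CommRing R]
    [IsRegularLocalRing R] (h : ringKrullDim R ≤ 1) : IsPrincipalIdealRing R :=
  have := IsRegularLocalRing.isDomain_of_ringKrullDim_le_one h
  ((tfae_of_isNoetherianRing_of_isLocalRing_of_isDomain R).out 0 4).mpr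
    (IsRegularLocalRing.isPrincipal_maximalIdeal h)

/-! ### Dimension and transcendence degree -/

theorem ringKrullDim_le_of_isIntegral {A B : Type*} [CommRing A] [CommRing B] [Algebra A B]
    [Algebra.IsIntegral A B] : ringKrullDim B ≤ ringKrullDim A :=
  Order.krullDim_le_of_strictMono (PrimeSpectrum.comap (algebraMap A B)) fun _ _ h ↦
    Ideal.IsIntegral.comap_lt_comap h

/-- Noether normalisation: `A` is integral over a polynomial ring in `s` variables, which embeds in
`L`, so `s ≤ 1`. -/
theorem ringKrullDim_le_one_of_trdeg_le_one {k A L : Type u} [Field k] [CommRing A] [IsDomain A]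
    [Algebra k A] [Algebra.FiniteType k A] [Field L] [Algebra k L] (f : A →ₐ[k] L)
    (hf : Function.Injective f) (hL : Algebra.trdeg k L ≤ 1) : ringKrullDim A ≤ 1 := by
  obtain ⟨s, g, hg, hint⟩ := exists_integral_inj_algHom_of_fg k A
  have hs : (s : Cardinal.{u}) ≤ 1 := by
    have h1 := trdeg_le_of_injective (f.comp g) (hf.comp hg)
    rw [MvPolynomial.trdeg_of_isDomain] at h1
    simpa using h1.trans hL
  have hs' : s ≤ 1 := by exact_mod_cast hs
  algebraize [g.toRingHom]
  have : Algebra.IsIntegral (MvPolynomial (Fin s) k) A := ⟨hint⟩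
  refine (ringKrullDim_le_of_isIntegral (A := MvPolynomial (Fin s) k)).trans ?_
  rw [MvPolynomial.ringKrullDim_of_isNoetherianRing, ringKrullDim_eq_zero_of_field]
  simpa using hs'

/-- A chain of length two that ends at `p` lies above some minimal prime `q`, so it is already a
chain in the spectrum of `A ⧸ q`. -/
theorem Ideal.height_le_one_of_forall_minimalPrimes {A : Type*} [CommRing A] (p : Ideal A)
    [p.IsPrime] (h : ∀ q ∈ minimalPrimes A, q ≤ p → ringKrullDim (A ⧸ q) ≤ 1) : p.height ≤ 1 := by
  by_contra! hp
  obtain ⟨l, hl, hlen⟩ := Order.exists_series_of_le_height (⟨p, ‹_›⟩ : PrimeSpectrum A) (n := 2)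
    (by rw [← PrimeSpectrum.height_eq_orderHeight]
        exact Order.add_one_le_of_lt hp)
  obtain ⟨q, hq, hql⟩ := Ideal.exists_minimalPrimes_le (J := l.head.asIdeal) (I := ⊥) bot_le
  have hmem (i) : l.toFun i ∈ PrimeSpectrum.zeroLocus (q : Set A) :=
    hql.trans (l.head_le i)
  have := h q hq (hql.trans (show l.head ≤ _ from hl ▸ l.head_le_last))
  rw [ringKrullDim_quotient] at this
  let l' : LTSeries (PrimeSpectrum.zeroLocus (q : Set A)) :=
    { length := l.length, toFun := fun i ↦ ⟨l.toFun i, hmem i⟩, step := l.step }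
  have h3 := (Order.LTSeries.length_le_krullDim l').trans this
  have h4 : l'.length = 2 := hlen
  rw [h4] at h3
  exact absurd (show (2 : ℕ) ≤ 1 by exact_mod_cast h3) (by norm_num)

open Algebra in
-- `B` is étale over `k[t]`, so the residue field of `q` is algebraic over the residue field of a
-- prime of `k[t]`.
theorem trdeg_residueField_le_one {k B : Type u} [Field k] [CommRing B] [Algebra k B]
    [Algebra.IsStandardSmoothOfRelativeDimension 1 k B] (q : Ideal B) [q.IsPrime] :
    Algebra.trdeg k q.ResidueField ≤ 1 := by
  obtain ⟨g, hg⟩ := Algebra.IsStandardSmoothOfRelativeDimension.exists_etale_mvPolynomial 1 k B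
  algebraize [g.toRingHom]
  have : Algebra.Etale (MvPolynomial (Fin 1) k) B := hg
  let P := q.under (MvPolynomial (Fin 1) k)
  have : q.LiesOver P := ⟨rfl⟩
  let := Localization.AtPrime.algebraOfLiesOver P q
  let : Algebra (MvPolynomial (Fin 1) k ⧸ P) q.ResidueField :=
    ((algebraMap P.ResidueField q.ResidueField).comp
      (algebraMap (MvPolynomial (Fin 1) k ⧸ P) P.ResidueField)).toAlgebra
  have : IsScalarTower (MvPolynomial (Fin 1) k ⧸ P) P.ResidueField q.ResidueField :=
    .of_algebraMap_eq' rfl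
  have : Algebra.IsAlgebraic (MvPolynomial (Fin 1) k ⧸ P) q.ResidueField :=
    have : Algebra.IsAlgebraic P.ResidueField q.ResidueField := inferInstance
    Algebra.IsAlgebraic.trans _ P.ResidueField _
  have : FaithfulSMul (MvPolynomial (Fin 1) k ⧸ P) q.ResidueField := by
    rw [faithfulSMul_iff_algebraMap_injective,
      IsScalarTower.algebraMap_eq _ P.ResidueField q.ResidueField]
    exact (algebraMap P.ResidueField q.ResidueField).injective.comp
      P.injective_algebraMap_quotient_residueField
  have htower (r : k) : algebraMap (MvPolynomial (Fin 1) k ⧸ P) q.ResidueField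
      (algebraMap k (MvPolynomial (Fin 1) k ⧸ P) r) = algebraMap k q.ResidueField r := by
    rw [IsScalarTower.algebraMap_apply k (MvPolynomial (Fin 1) k) (MvPolynomial (Fin 1) k ⧸ P),
      IsScalarTower.algebraMap_apply (MvPolynomial (Fin 1) k ⧸ P) P.ResidueField q.ResidueField,
      ← IsScalarTower.algebraMap_apply _ _ P.ResidueField,
      ← IsScalarTower.algebraMap_apply _ P.ResidueField q.ResidueField,
      IsScalarTower.algebraMap_apply _ B q.ResidueField, IsScalarTower.algebraMap_apply k B q.ResidueField,
      IsScalarTower.algebraMap_apply k (MvPolynomial (Fin 1) k) B]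
  have : IsScalarTower k (MvPolynomial (Fin 1) k ⧸ P) q.ResidueField := by
    refine IsScalarTower.of_algebraMap_smul (R := k) (A := MvPolynomial (Fin 1) k ⧸ P)
      (M := q.ResidueField) fun r x ↦ ?_
    rw [Algebra.smul_def, Algebra.smul_def, htower]
  rw [← trdeg_add_eq k (MvPolynomial (Fin 1) k ⧸ P) (A := q.ResidueField),
    trdeg_eq_zero (R := MvPolynomial (Fin 1) k ⧸ P), add_zero]
  refine (trdeg_le_of_surjective (Ideal.Quotient.mkₐ k P) (Ideal.Quotient.mkₐ_surjective k P)).trans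
    ?_
  rw [MvPolynomial.trdeg_of_isDomain]
  simp

/-! ### Counting points of projectivisations -/

/-- For a free action of `G` on `α`, the preimage in `α` of a set of orbits `P` has `|P| * |G|`
elements. -/
theorem MulAction.card_orbitRel_quotient_subtype {G α : Type*} [Group G] [MulAction G α]
    (h : ∀ (g : G) (a : α), g • a = a → g = 1) (P : MulAction.orbitRel.Quotient G α → Prop) :
    Nat.card {a : α // P (Quotient.mk (MulAction.orbitRel G α) a)} =
      Nat.card {x // P x} * Nat.card G := by
  rw [← Nat.card_prod]
  have hmk (g : G) (a : α) : Quotient.mk (MulAction.orbitRel G α) (g • a) =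
      Quotient.mk (MulAction.orbitRel G α) a := Quotient.sound ⟨g, rfl⟩
  refine (Nat.card_congr (Equiv.ofBijective (fun p : {x // P x} × G ↦
    (⟨p.2 • p.1.1.out, ?_⟩ : {a : α // P (Quotient.mk (MulAction.orbitRel G α) a)}))
      ⟨?_, ?_⟩)).symm
  · rw [hmk, Quotient.out_eq]
    exact p.1.2
  · rintro ⟨⟨x, hx⟩, g⟩ ⟨⟨y, hy⟩, g'⟩ hxy
    have h1 : g • x.out = g' • y.out := congrArg Subtype.val hxy
    have h2 : x = y :=
      (Quotient.out_eq x).symm.trans (((hmk g _).symm.trans (congrArg _ h1)).trans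
        ((hmk g' _).trans (Quotient.out_eq y)))
    subst h2
    have h3 := h (g'⁻¹ * g) x.out (by rw [mul_smul, h1, inv_smul_smul])
    rw [inv_mul_eq_one] at h3
    rw [h3]
  · rintro ⟨a, ha⟩
    obtain ⟨g, hg⟩ := Quotient.mk_out (s := MulAction.orbitRel G α) a
    refine ⟨⟨⟨_, ha⟩, g⁻¹⟩, Subtype.ext ?_⟩
    change g⁻¹ • (Quotient.mk (MulAction.orbitRel G α) a).out = a
    rw [← hg]
    exact inv_smul_smul g a

theorem ZMod.isUnit_of_pow_mul_ne_zero {ℓ n : ℕ} [Fact ℓ.Prime] (hn : 1 ≤ n) {x : ZMod (ℓ ^ n)}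
    (hx : (ℓ : ZMod (ℓ ^ n)) ^ (n - 1) * x ≠ 0) : IsUnit x := by
  have : NeZero (ℓ ^ n) := ⟨pow_ne_zero _ (Fact.out : ℓ.Prime).ne_zero⟩
  obtain ⟨a, rfl⟩ := ZMod.natCast_zmod_surjective x
  rw [ZMod.isUnit_iff_coprime]
  refine Nat.Coprime.pow_right _ (Nat.Coprime.symm ((Fact.out : ℓ.Prime).coprime_iff_not_dvd.mpr ?_))
  rintro ⟨c, rfl⟩
  refine hx ?_
  have : ((ℓ ^ n * c : ℕ) : ZMod (ℓ ^ n)) = 0 := by simp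
  rw [← this]
  obtain ⟨n, rfl⟩ := Nat.exists_eq_add_of_le' hn
  push_cast
  ring

theorem Nat.card_units_zmod_prime_pow {ℓ n : ℕ} [Fact ℓ.Prime] (hn : 1 ≤ n) :
    Nat.card (ZMod (ℓ ^ n))ˣ = ℓ ^ (n - 1) * (ℓ - 1) := by
  have : NeZero (ℓ ^ n) := ⟨pow_ne_zero _ (Fact.out : ℓ.Prime).ne_zero⟩
  rw [Nat.card_eq_fintype_card, ZMod.card_units_eq_totient,
    Nat.totient_prime_pow Fact.out (by omega)]

/-! ### Free modules over `ℤ/ℓⁿ`: freeness of the unit action on `V^*` -/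

section Free

variable {ℓ n b : ℕ} [Fact ℓ.Prime] {M : Type*} [AddCommGroup M] [Module (ZMod (ℓ ^ n)) M]

theorem exists_isUnit_coord_of_nsmul_ne_zero (e : M ≃ₗ[ZMod (ℓ ^ n)] (Fin b → ZMod (ℓ ^ n)))
    (hn : 1 ≤ n) {v : M} (hv : ℓ ^ (n - 1) • v ≠ 0) :
    ∃ i, IsUnit (e v i) := by
  have h1 : e (ℓ ^ (n - 1) • v) ≠ 0 := fun h ↦ hv (e.injective (h.trans (map_zero e).symm))
  obtain ⟨i, hi⟩ := Function.ne_iff.mp h1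
  refine ⟨i, ZMod.isUnit_of_pow_mul_ne_zero hn ?_⟩
  rw [map_nsmul, Pi.smul_apply, nsmul_eq_mul] at hi
  simpa using hi

/-- A vector of `V^*` has a unit among its coordinates, and this coordinate can be cancelled. -/
theorem ModStar.smul_eq_self (e : M ≃ₗ[ZMod (ℓ ^ n)] (Fin b → ZMod (ℓ ^ n)))
    (hn : 1 ≤ n) (c : (ZMod (ℓ ^ n))ˣ) (v : ModStar ℓ n M)
    (h : c • v = v) : c = 1 := by
  obtain ⟨i, hi⟩ := exists_isUnit_coord_of_nsmul_ne_zero e hn v.2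
  have h1 : (c : ZMod (ℓ ^ n)) • v.1 = v.1 := congrArg Subtype.val h
  have h2 := congrFun (congrArg e h1) i
  rw [map_smul, Pi.smul_apply, smul_eq_mul] at h2
  exact Units.ext (hi.mul_right_cancel (h2.trans (one_mul _).symm))

theorem natCard_free (e : M ≃ₗ[ZMod (ℓ ^ n)] (Fin b → ZMod (ℓ ^ n))) : Nat.card M = ℓ ^ (n * b) := by
  have : NeZero (ℓ ^ n) := ⟨pow_ne_zero _ (Fact.out : ℓ.Prime).ne_zero⟩
  rw [Nat.card_congr e.toEquiv, Nat.card_fun, Nat.card_zmod, Nat.card_eq_fintype_card,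
    Fintype.card_fin, pow_mul]

end Free

theorem ModProj.natCard_one {ℓ b : ℕ} [Fact ℓ.Prime] {M : Type*} [AddCommGroup M]
    [Module (ZMod (ℓ ^ 1)) M] (e : M ≃ₗ[ZMod (ℓ ^ 1)] (Fin b → ZMod (ℓ ^ 1))) :
    Nat.card (ModProj ℓ 1 M) * (ℓ - 1) = ℓ ^ b - 1 := by
  have h := MulAction.card_orbitRel_quotient_subtype (ModStar.smul_eq_self e le_rfl)
    (fun _ ↦ True)
  have h1 : Nat.card (ModStar ℓ 1 M) = ℓ ^ b - 1 := by
    have hfin : Finite M := Nat.finite_of_card_ne_zero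
      (by rw [natCard_free e]; exact pow_ne_zero _ (Fact.out : ℓ.Prime).ne_zero)
    have : Nat.card (ModStar ℓ 1 M) = Nat.card {v : M // v ≠ 0} :=
      Nat.card_congr (Equiv.subtypeEquivRight fun v ↦ by simp)
    rw [this]
    have := Fintype.ofFinite M
    classical
    rw [Nat.card_eq_fintype_card, Fintype.card_subtype_compl, Fintype.card_subtype_eq,
      ← Nat.card_eq_fintype_card, natCard_free e, one_mul]
  rw [Nat.card_congr (Equiv.subtypeUnivEquiv fun _ ↦ trivial),
    Nat.card_congr (Equiv.subtypeUnivEquiv fun _ ↦ trivial), h1,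
    Nat.card_units_zmod_prime_pow le_rfl] at h
  rw [Nat.sub_self, pow_zero, one_mul] at h
  exact h.symm

/-! ### Fibres of the transition maps between projectivisations -/

section Transition

variable {ℓ m n b : ℕ} {M N : Type*} [AddCommGroup M] [Module (ZMod (ℓ ^ m)) M]
  [AddCommGroup N] [Module (ZMod (ℓ ^ n)) N]

theorem map_units_smul_zmod (f : M →+ N) (hm : n ≤ m) (c : (ZMod (ℓ ^ m))ˣ) (v : M) :
    f (c • v) = Units.map (ZMod.castHom (pow_dvd_pow ℓ hm) (ZMod (ℓ ^ n))).toMonoidHom c • f v := by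
  obtain ⟨z, hz⟩ := ZMod.intCast_surjective (c : ZMod (ℓ ^ m))
  change f ((c : ZMod (ℓ ^ m)) • v) =
    (ZMod.castHom (pow_dvd_pow ℓ hm) (ZMod (ℓ ^ n)) (c : ZMod (ℓ ^ m))) • f v
  rw [← hz, map_intCast, Int.cast_smul_eq_zsmul, Int.cast_smul_eq_zsmul, map_zsmul]

/-- The map `M^* → N^*` given by an additive map with kernel killed by `ℓ`. -/
def ModStar.map (f : M →+ N) (hf : ∀ v, f v = 0 → ℓ • v = 0) (hn : 1 ≤ n) (hm : m = n + 1)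
    (v : ModStar ℓ m M) : ModStar ℓ n N :=
  ⟨f v.1, fun h ↦ v.2 (by
    have := hf (ℓ ^ (n - 1) • v.1) (by rw [map_nsmul, h])
    rwa [smul_smul, ← pow_succ', show n - 1 + 1 = m - 1 by omega] at this)⟩

/-- The map `P_{n+1}(M) → P_n(N)` given by an additive map with kernel killed by `ℓ`. -/
def ModProj.map (f : M →+ N) (hf : ∀ v, f v = 0 → ℓ • v = 0) (hn : 1 ≤ n) (hm : m = n + 1) :
    ModProj ℓ m M → ModProj ℓ n N :=
  Quotient.map (ModStar.map f hf hn hm) (by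
    rintro _ v ⟨c, rfl⟩
    exact ⟨Units.map (ZMod.castHom (pow_dvd_pow ℓ (by omega)) (ZMod (ℓ ^ n))).toMonoidHom c,
      Subtype.ext (map_units_smul_zmod f (by omega) c v.1).symm⟩)

variable [Fact ℓ.Prime]

/-- In `ℤ/ℓⁿ⁺¹` the `ℓ`-torsion consists of the classes `ℓⁿ t` with `0 ≤ t < ℓ`. -/
theorem natCard_torsion_le (eM : M ≃ₗ[ZMod (ℓ ^ m)] (Fin b → ZMod (ℓ ^ m)))
    (hm : m = n + 1) :
    Nat.card {v : M // ℓ • v = 0} ≤ ℓ ^ b := by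
  have : NeZero (ℓ ^ m) := ⟨pow_ne_zero _ (Fact.out : ℓ.Prime).ne_zero⟩
  have key (x : ZMod (ℓ ^ m)) (hx : (ℓ : ZMod (ℓ ^ m)) * x = 0) :
      ∃ t : Fin ℓ, x = ((ℓ ^ n * t : ℕ) : ZMod (ℓ ^ m)) := by
    have h1 : ((ℓ * x.val : ℕ) : ZMod (ℓ ^ m)) = 0 := by simpa using hx
    rw [ZMod.natCast_eq_zero_iff] at h1
    have hpow : ℓ ^ m = ℓ * ℓ ^ n := by rw [hm, pow_succ']
    obtain ⟨t, ht⟩ := Nat.dvd_of_mul_dvd_mul_left (Fact.out : ℓ.Prime).pos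
      (hpow.symm.dvd.trans h1)
    have h2 : ℓ ^ n * t < ℓ ^ n * ℓ := by
      rw [← ht, mul_comm, ← hpow]
      exact ZMod.val_lt x
    refine ⟨⟨t, lt_of_mul_lt_mul_left h2 (Nat.zero_le _)⟩, ?_⟩
    rw [← ht, ZMod.natCast_zmod_val]
  have hsurj : ∀ v : {v : M // ℓ • v = 0}, ∃ t : Fin b → Fin ℓ,
      ∀ i, eM v.1 i = ((ℓ ^ n * t i : ℕ) : ZMod (ℓ ^ m)) := fun v ↦ by
    choose t ht using fun i ↦ key (eM v.1 i) (by
      have := congrFun (congrArg eM v.2) i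
      rwa [map_nsmul, map_zero, Pi.smul_apply, nsmul_eq_mul] at this)
    exact ⟨t, ht⟩
  choose t ht using hsurj
  have hinj : Function.Injective t := fun v w h ↦ Subtype.ext (eM.injective (by
    ext i
    rw [ht, ht, h]))
  refine (Nat.card_le_card_of_injective t hinj).trans ?_
  simp

/-- The kernel lies in the `ℓ`-torsion, so it has at most `ℓ^b` elements. Since `|ker| · |range| =
|M| = ℓ^b |N|`, both this bound and `|range| ≤ |N|` must be equalities. -/
theorem natCard_ker_and_surjective
    (eM : M ≃ₗ[ZMod (ℓ ^ m)] (Fin b → ZMod (ℓ ^ m)))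
    (eN : N ≃ₗ[ZMod (ℓ ^ n)] (Fin b → ZMod (ℓ ^ n)))
    (f : M →+ N) (hf : ∀ v, f v = 0 → ℓ • v = 0)
    (hm : m = n + 1) : Nat.card f.ker = ℓ ^ b ∧ Function.Surjective f := by
  have hℓ := (Fact.out : ℓ.Prime).pos
  have hM := natCard_free eM
  have hN := natCard_free eN
  have : Finite M := Nat.finite_of_card_ne_zero (by rw [hM]; positivity)
  have : Finite N := Nat.finite_of_card_ne_zero (by rw [hN]; positivity)
  have hker : Nat.card f.ker ≤ ℓ ^ b :=
    (Nat.card_le_card_of_injective (fun v : f.ker ↦ (⟨v.1, hf _ v.2⟩ : {v : M // ℓ • v = 0}))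
      fun v w h ↦ Subtype.ext (by simpa using h)).trans (natCard_torsion_le eM hm)
  have hprod : Nat.card f.ker * Nat.card f.range = Nat.card M := by
    rw [← AddSubgroup.index_ker, AddSubgroup.card_mul_index]
  have hran : Nat.card f.range ≤ Nat.card N :=
    Nat.card_le_card_of_injective Subtype.val Subtype.val_injective
  have hmul : Nat.card M = ℓ ^ b * Nat.card N := by
    rw [hM, hN, hm, ← pow_add]
    congr 1
    ring
  have hNpos : 0 < Nat.card N := by rw [hN]; positivity
  rw [hmul] at hprod
  have h1 : Nat.card f.ker = ℓ ^ b := by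
    refine le_antisymm hker (le_of_mul_le_mul_right (hprod.ge.trans ?_) hNpos)
    exact Nat.mul_le_mul_left _ hran
  refine ⟨h1, ?_⟩
  rw [h1] at hprod
  have h2 : Nat.card f.range = Nat.card N := Nat.eq_of_mul_eq_mul_left (by positivity) hprod
  rw [← AddMonoidHom.range_eq_top]
  exact AddSubgroup.eq_top_of_card_eq _ h2

/-- Converse to `ModStar.map`: every preimage of a vector of `N^*` is in `M^*`. Otherwise `v = ℓu`
by freeness of `M`, and then `ℓ^(n-1) f(v) = ℓⁿ f(u) = 0`. -/
theorem nsmul_ne_zero_of_map_nsmul_ne_zero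
    (eM : M ≃ₗ[ZMod (ℓ ^ m)] (Fin b → ZMod (ℓ ^ m)))
    (eN : N ≃ₗ[ZMod (ℓ ^ n)] (Fin b → ZMod (ℓ ^ n)))
    (f : M →+ N) (hn : 1 ≤ n) (hm : m = n + 1) {v : M}
    (hv : ℓ ^ (n - 1) • f v ≠ 0) : ℓ ^ (m - 1) • v ≠ 0 := by
  intro h
  have : NeZero (ℓ ^ m) := ⟨pow_ne_zero _ (Fact.out : ℓ.Prime).ne_zero⟩
  have key (x : ZMod (ℓ ^ m)) (hx : ((ℓ ^ (m - 1) : ℕ) : ZMod (ℓ ^ m)) * x = 0) :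
      ∃ t : ZMod (ℓ ^ m), x = ℓ • t := by
    have h1 : ((ℓ ^ (m - 1) * x.val : ℕ) : ZMod (ℓ ^ m)) = 0 := by
      rw [Nat.cast_mul, ZMod.natCast_zmod_val, hx]
    rw [ZMod.natCast_eq_zero_iff] at h1
    have hpow : ℓ ^ m = ℓ ^ (m - 1) * ℓ := by rw [← pow_succ, show m - 1 + 1 = m by omega]
    obtain ⟨t, ht⟩ := Nat.dvd_of_mul_dvd_mul_left (pow_pos (Fact.out : ℓ.Prime).pos _)
      (hpow.symm.dvd.trans h1)
    refine ⟨t, ?_⟩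
    rw [nsmul_eq_mul, ← Nat.cast_mul, ← ht, ZMod.natCast_zmod_val]
  choose t ht using fun i ↦ key (eM v i) (by
    have := congrFun (congrArg eM h) i
    rwa [map_nsmul, map_zero, Pi.smul_apply, nsmul_eq_mul] at this)
  have hv' : v = ℓ • eM.symm t := eM.injective (by
    rw [map_nsmul, LinearEquiv.apply_symm_apply]
    ext i
    exact ht i)
  refine hv ?_
  rw [hv', map_nsmul, smul_smul, ← pow_succ, Nat.sub_add_cancel hn]
  refine eN.injective ?_
  rw [map_nsmul, map_zero]
  ext i
  rw [Pi.smul_apply, nsmul_eq_mul, ZMod.natCast_self, zero_mul, Pi.zero_apply]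

/-- The fibres of `P_{n+1}(M) → P_n(N)` have `ℓ^(b-1)` elements. -/
theorem ModProj.natCard_fiber_map
    (eM : M ≃ₗ[ZMod (ℓ ^ m)] (Fin b → ZMod (ℓ ^ m)))
    (eN : N ≃ₗ[ZMod (ℓ ^ n)] (Fin b → ZMod (ℓ ^ n)))
    (f : M →+ N) (hf : ∀ v, f v = 0 → ℓ • v = 0) (hn : 1 ≤ n)
    (hm : m = n + 1) (y : ModProj ℓ n N) :
    Nat.card {x : ModProj ℓ m M // ModProj.map f hf hn hm x = y} * ℓ = ℓ ^ b := by
  obtain ⟨w, rfl⟩ := Quotient.exists_rep y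
  have h := MulAction.card_orbitRel_quotient_subtype (ModStar.smul_eq_self eM (by omega))
    (fun x ↦ ModProj.map f hf hn hm x = Quotient.mk _ w)
  obtain ⟨hker, hsurj⟩ := natCard_ker_and_surjective eM eN f hf hm
  let s := Function.surjInv hsurj
  have hs (x) : f (s x) = x := Function.surjInv_eq hsurj x
  -- A vector `v` lies over `[w]` exactly if `f v = c • w` for a unit `c`, which is unique by
  -- freeness. Then `v` is `s (c • w)` plus an element of the kernel, where `s` is a set-theoretic
  -- section of `f`.
  have hcount : Nat.card {v : ModStar ℓ m M // ModProj.map f hf hn hm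
      (Quotient.mk (MulAction.orbitRel (ZMod (ℓ ^ m))ˣ (ModStar ℓ m M)) v) = Quotient.mk _ w} =
      Nat.card ((ZMod (ℓ ^ n))ˣ × f.ker) := by
    symm
    have hval (c : (ZMod (ℓ ^ n))ˣ) (κ : f.ker) : f (s (c • w).1 + κ.1) = (c • w).1 := by
      rw [map_add, hs, show f κ.1 = 0 from κ.2, add_zero]
    refine Nat.card_congr (Equiv.ofBijective (fun p ↦ ⟨⟨s (p.1 • w).1 + p.2.1,
      nsmul_ne_zero_of_map_nsmul_ne_zero eM eN f hn hm (by rw [hval]; exact (p.1 • w).2)⟩,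
      Quotient.sound ⟨p.1, Subtype.ext (hval p.1 p.2).symm⟩⟩) ⟨?_, ?_⟩)
    · rintro ⟨c, κ⟩ ⟨c', κ'⟩ hcc
      have h1 : s (c • w).1 + κ.1 = s (c' • w).1 + κ'.1 :=
        congrArg (fun x ↦ x.1.1) hcc
      have h2 : c • w = c' • w := Subtype.ext (by rw [← hval c κ, ← hval c' κ', h1])
      have h3 : c = c' := by
        have := ModStar.smul_eq_self eN hn (c'⁻¹ * c) w (by rw [mul_smul, h2, inv_smul_smul])
        rw [inv_mul_eq_one] at this
        exact this.symm
      subst h3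
      rw [Subtype.ext (add_left_cancel h1)]
    · rintro ⟨v, hv⟩
      obtain ⟨c, hc⟩ := Quotient.exact hv
      have hc' : (c • w).1 = f v.1 := congrArg Subtype.val hc
      refine ⟨⟨c, ⟨v.1 - s (c • w).1, ?_⟩⟩, Subtype.ext (Subtype.ext ?_)⟩
      · rw [AddMonoidHom.mem_ker, map_sub, hs, hc', sub_self]
      · exact add_sub_cancel _ _
  change _ = Nat.card {x : ModProj ℓ m M // ModProj.map f hf hn hm x = Quotient.mk _ w} * _ at h
  rw [hcount, Nat.card_prod, hker, Nat.card_units_zmod_prime_pow hn,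
    Nat.card_units_zmod_prime_pow (by omega)] at h
  have hℓ : 1 < ℓ := (Fact.out : ℓ.Prime).one_lt
  have hpos : 0 < ℓ ^ (n - 1) * (ℓ - 1) := Nat.mul_pos (pow_pos (by omega) _) (by omega)
  refine Nat.eq_of_mul_eq_mul_left hpos ?_
  rw [h, show m - 1 = (n - 1) + 1 by omega, pow_succ]
  ring

end Transition

/-! ### Local rings of regular compactifications of curves -/

/-- There are finitely many minimal primes, so the points that lie on no component other than that
of `q` form an open neighbourhood of `q`. It meets `D` in some `z`, and `q` specialises to `z`. -/
theorem PrimeSpectrum.mem_of_dense_of_mem_minimalPrimes {R : Type*} [CommRing R]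
    [IsNoetherianRing R] {D : Set (PrimeSpectrum R)} (hD : IsOpen D) (hD' : Dense D)
    (q : PrimeSpectrum R) (hq : q.asIdeal ∈ minimalPrimes R) : q ∈ D := by
  have hfin : {r : PrimeSpectrum R | r.asIdeal ∈ minimalPrimes R ∧ r ≠ q}.Finite :=
    ((minimalPrimes.finite_of_isNoetherianRing R).preimage
      (fun _ _ _ _ h ↦ PrimeSpectrum.ext h)).subset fun r hr ↦ hr.1
  have hopen : IsOpen (⋃ r ∈ {r : PrimeSpectrum R | r.asIdeal ∈ minimalPrimes R ∧ r ≠ q},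
      closure {r})ᶜ := (hfin.isClosed_biUnion fun _ _ ↦ isClosed_closure).isOpen_compl
  obtain ⟨z, hz, hzD⟩ := hD'.inter_open_nonempty _ hopen ⟨q, by
    simp only [Set.mem_compl_iff, Set.mem_iUnion, not_exists]
    intro r hr hqr
    rw [← specializes_iff_mem_closure, ← PrimeSpectrum.le_iff_specializes] at hqr
    exact hr.2 (le_antisymm hqr (hq.2 ⟨r.2, bot_le⟩ hqr))⟩
  obtain ⟨r, hr, hrz⟩ := Ideal.exists_minimalPrimes_le (J := z.asIdeal) (I := ⊥) bot_le
  have hrq : (⟨r, hr.1.1⟩ : PrimeSpectrum R) = q := by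
    by_contra hne
    refine hz (Set.mem_biUnion (x := (⟨r, hr.1.1⟩ : PrimeSpectrum R)) ⟨hr, hne⟩ ?_)
    rw [← specializes_iff_mem_closure, ← PrimeSpectrum.le_iff_specializes]
    exact hrz
  have hsp : q ⤳ z := (PrimeSpectrum.le_iff_specializes _ _).mp (hrq ▸ hrz)
  exact hsp.mem_open hD hzD

namespace AlgebraicGeometry

theorem asIdeal_SpecMap_field {R : CommRingCat.{u}} {L : Type u} [Field L]
    (f : R ⟶ CommRingCat.of L) (x : Spec (.of L)) :
    PrimeSpectrum.asIdeal (Spec.map f x) = RingHom.ker f.hom := by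
  have hx : x.asIdeal = ⊥ := (Ideal.eq_bot_or_top _).resolve_right x.isPrime.ne_top
  change Ideal.comap f.hom x.asIdeal = _
  rw [hx]
  rfl

theorem ringKrullDim_stalk_eq_height {C : Scheme.{u}} {R : CommRingCat.{u}} (j : Spec R ⟶ C)
    [IsOpenImmersion j] (y : Spec R) :
    ringKrullDim (C.presheaf.stalk (j y)) = y.asIdeal.height := by
  rw [ringKrullDim_stalk_eq_coheight, idealHeight_eq_coheight]
  exact congrArg _ (coheight_eq_of_isOpenImmersion j)

theorem exists_point_trdeg_le_one {k : Type u} [Field k] {X : Scheme.{u}} (s : X ⟶ Spec (.of k))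
    [SmoothOfRelativeDimension 1 s] (x : X) :
    ∃ (L : Type u) (_ : Field L) (_ : Algebra k L) (i : Spec (.of L) ⟶ X),
      i default = x ∧ i ≫ s = Spec.map (CommRingCat.ofHom (algebraMap k L)) ∧
      Algebra.trdeg k L ≤ 1 := by
  obtain ⟨U, hU, V, hV, hxV, e, hsm⟩ :=
    SmoothOfRelativeDimension.exists_isStandardSmoothOfRelativeDimension (n := 1) (f := s) x
  obtain rfl : U = ⊤ := by
    ext z
    have := e hxV
    exact ⟨fun _ ↦ trivial, fun _ ↦ Subsingleton.elim (s x) z ▸ this⟩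
  have : IsIso hU.fromSpec := by
    have : Surjective hU.fromSpec := ⟨fun z ↦ by
      have : z ∈ Set.range hU.fromSpec := by rw [hU.range_fromSpec]; trivial
      exact this⟩
    exact (isIso_iff_isOpenImmersion_and_surjective _).mpr ⟨inferInstance, inferInstance⟩
  let ψ : CommRingCat.of k ⟶ Γ(X, V) := Spec.preimage (hV.fromSpec ≫ s)
  have hψ : ψ = Spec.preimage hU.fromSpec ≫ s.appLE ⊤ V e := by
    apply Spec.map_injective
    rw [Spec.map_preimage, Spec.map_comp, Spec.map_preimage, IsAffineOpen.SpecMap_appLE_fromSpec]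
  have hψs : ψ.hom.IsStandardSmoothOfRelativeDimension 1 := by
    rw [hψ]
    have : IsIso (Spec.preimage hU.fromSpec) := by
      have : IsIso (Spec.map (Spec.preimage hU.fromSpec)) := by rwa [Spec.map_preimage]
      exact (ConcreteCategory.isIso_iff_bijective _).mpr (isIso_SpecMap_iff.mp this)
    exact (RingHom.isStandardSmoothOfRelativeDimension_respectsIso).2 _
      (asIso (Spec.preimage hU.fromSpec)).commRingCatIsoToRingEquiv hsm
  algebraize [ψ.hom]
  let q := hV.primeIdealOf ⟨x, hxV⟩
  refine ⟨q.asIdeal.ResidueField, inferInstance, inferInstance,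
    Spec.map (CommRingCat.ofHom (algebraMap Γ(X, V) q.asIdeal.ResidueField)) ≫ hV.fromSpec, ?_,
    ?_, trdeg_residueField_le_one _⟩
  · rw [Scheme.Hom.comp_apply]
    have : Spec.map (CommRingCat.ofHom (algebraMap Γ(X, V) q.asIdeal.ResidueField))
        (default : Spec (.of q.asIdeal.ResidueField)) = q :=
      PrimeSpectrum.ext ((asIdeal_SpecMap_field _ _).trans
        (Ideal.ker_algebraMap_residueField q.asIdeal))
    rw [this, hV.fromSpec_primeIdealOf]
  · rw [Category.assoc, ← Spec.map_preimage (hV.fromSpec ≫ s), ← Spec.map_comp]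
    rfl

/-- The dimension of `C` is not given; density of `X` bounds it. The generic point of each component
of an affine chart lies in `X`, where residue fields have transcendence degree at most one, and the
coordinate ring of the component embeds in that field. -/
theorem ringKrullDim_stalk_le_one {k : Type u} [Field k] {X C : Scheme.{u}}
    (str : C ⟶ Spec (.of k)) [LocallyOfFiniteType str] (ι : X ⟶ C) [IsOpenImmersion ι]
    [IsDominant ι] [SmoothOfRelativeDimension 1 (ι ≫ str)] (x : C) :
    ringKrullDim (C.presheaf.stalk x) ≤ 1 := by
  obtain ⟨R, j, _, y, rfl⟩ := C.exists_Spec_apply_eq x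
  rw [ringKrullDim_stalk_eq_height]
  let ψ : CommRingCat.of k ⟶ R := Spec.preimage (j ≫ str)
  have hψ : ψ.hom.FiniteType := by
    rw [← HasRingHomProperty.Spec_iff (P := @LocallyOfFiniteType), Spec.map_preimage]
    infer_instance
  algebraize [ψ.hom]
  have : IsNoetherianRing R := Algebra.FiniteType.isNoetherianRing k R
  have hy : y.asIdeal.IsPrime := y.isPrime
  have hle := Ideal.height_le_one_of_forall_minimalPrimes y.asIdeal fun q hq _ ↦ by
    have : q.IsPrime := hq.1.1
    have hmem := PrimeSpectrum.mem_of_dense_of_mem_minimalPrimes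
      (D := (j ⁻¹' (Set.range ι) : Set (Spec R)))
      (ι.isOpenEmbedding.isOpen_range.preimage j.continuous)
      (ι.denseRange.preimage j.isOpenEmbedding.isOpenMap) ⟨q, hq.1.1⟩ hq
    obtain ⟨z, hz⟩ := hmem
    obtain ⟨L, _, _, i, hi, his, hL⟩ := exists_point_trdeg_le_one (ι ≫ str) z
    have hrange : Set.range (i ≫ ι) ⊆ Set.range j := by
      rintro _ ⟨t, rfl⟩
      rw [Subsingleton.elim t default, Scheme.Hom.comp_apply, hi, hz]
      exact ⟨_, rfl⟩
    let f : R ⟶ CommRingCat.of L := Spec.preimage (IsOpenImmersion.lift j (i ≫ ι) hrange)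
    have hf : Spec.map f ≫ j = i ≫ ι := by
      rw [Spec.map_preimage, IsOpenImmersion.lift_fac]
    have hcomm : ψ ≫ f = CommRingCat.ofHom (algebraMap k L) := by
      apply Spec.map_injective
      rw [Spec.map_comp, Spec.map_preimage ( _ ≫ str), reassoc_of% hf, his]
    let fa : R →ₐ[k] L := { f.hom with
      commutes' := fun r ↦ congrArg (fun g ↦ g.hom r) hcomm }
    have hker : RingHom.ker f.hom = q := by
      have h1 : j ((Spec.map f) (default : Spec (.of L))) = j ⟨q, hq.1.1⟩ := by
        rw [← Scheme.Hom.comp_apply, hf, Scheme.Hom.comp_apply, hi, hz]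
      have h2 := congrArg PrimeSpectrum.asIdeal (j.isOpenEmbedding.injective h1)
      refine Eq.trans ?_ h2
      exact (asIdeal_SpecMap_field f _).symm
    have hker' : RingHom.ker fa = q := hker
    refine ringKrullDim_le_one_of_trdeg_le_one
      (Ideal.Quotient.liftₐ q fa (fun a ha ↦ by rwa [← hker'] at ha)) ?_ hL
    rw [injective_iff_map_eq_zero]
    intro a ha
    obtain ⟨a, rfl⟩ := Ideal.Quotient.mk_surjective a
    rw [Ideal.Quotient.eq_zero_iff_mem, ← hker']
    exact ha
  exact_mod_cast hle

end AlgebraicGeometry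

namespace AlgebraicGeometry

/-! ### Extending morphisms from curves to proper schemes -/

theorem isDominant_pullback_fst_of_isOpenImmersion {X P C : Scheme.{u}} (p : P ⟶ C)
    [IsOpenImmersion p] (ι : X ⟶ C) [IsOpenImmersion ι] [IsDominant ι] :
    IsDominant (pullback.fst p ι) where
  denseRange := by
    rw [DenseRange, IsOpenImmersion.range_pullbackFst]
    exact ι.denseRange.preimage p.isOpenEmbedding.isOpenMap

theorem IsDominant.of_comp_isOpenImmersion {A P W : Scheme.{u}} (a : A ⟶ P) (j : P ⟶ W)
    [IsOpenImmersion j] [IsDominant (a ≫ j)] : IsDominant a where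
  denseRange := by
    refine dense_iff_inter_open.mpr fun V hV ⟨v, hv⟩ ↦ ?_
    obtain ⟨_, ⟨w, hw, hjw⟩, t, rfl⟩ := (a ≫ j).denseRange.inter_open_nonempty (j '' V)
      (j.isOpenEmbedding.isOpenMap _ hV) ⟨_, v, hv, rfl⟩
    rw [Scheme.Hom.comp_apply] at hjw
    exact ⟨w, hw, t, (j.isOpenEmbedding.injective hjw).symm⟩

theorem isDominant_SpecMap_of_injective {R S : CommRingCat.{u}} (f : R ⟶ S)
    (hf : Function.Injective f) : IsDominant (Spec.map f) where
  denseRange := by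
    refine (PrimeSpectrum.denseRange_comap_iff_ker_le_nilRadical f.hom).mpr ?_
    rw [(RingHom.injective_iff_ker_eq_bot f.hom).mp hf]
    exact bot_le

/-- If the germ map is injective, `Γ(C, W)` embeds in the fraction field of the stalk at `x`, so the
image of the spectrum of that field is a generic point of `W`. -/
theorem isDominant_fromSpecStalk_fractionRing {C : Scheme.{u}} {x : C} {W : C.Opens}
    (hW : IsAffineOpen W) (hx : x ∈ W) [IsDomain (C.presheaf.stalk x)]
    (hinj : Function.Injective (C.presheaf.germ W x hx)) :
    IsDominant (Spec.map (CommRingCat.ofHom (algebraMap (C.presheaf.stalk x)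
      (FractionRing (C.presheaf.stalk x)))) ≫ W.fromSpecStalkOfMem x hx) := by
  have : IsOpenImmersion W.toSpecΓ := by
    rw [← hW.isoSpec_hom]
    infer_instance
  have : IsDominant ((Spec.map (CommRingCat.ofHom (algebraMap (C.presheaf.stalk x)
      (FractionRing (C.presheaf.stalk x)))) ≫ W.fromSpecStalkOfMem x hx) ≫ W.toSpecΓ) := by
    rw [Category.assoc, Scheme.Opens.fromSpecStalkOfMem_toSpecΓ, ← Spec.map_comp]
    refine isDominant_SpecMap_of_injective _ ?_
    exact (IsFractionRing.injective (C.presheaf.stalk x)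
      (FractionRing (C.presheaf.stalk x))).comp hinj
  exact IsDominant.of_comp_isOpenImmersion _ W.toSpecΓ

/-- The generic point near `x` lies in `X`, so `f` is defined there. The valuative criterion extends
it over the spectrum of the stalk at `x`, and this extension spreads out to a neighbourhood. There
it agrees with `f`, because both agree at a dominant point of the reduced scheme `W ∩ X`. -/
theorem exists_local_extension {S X Y C : Scheme.{u}} (sC : C ⟶ S) [IsLocallyNoetherian C]
    [IsReduced C] (ι : X ⟶ C) [IsOpenImmersion ι] [IsDominant ι] (sY : Y ⟶ S) [IsProper sY]
    (f : X ⟶ Y) (hf : f ≫ sY = ι ≫ sC) (x : C) [IsDomain (C.presheaf.stalk x)]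
    [ValuationRing (C.presheaf.stalk x)] :
    ∃ (W : C.Opens) (_ : x ∈ W) (g : W.toScheme ⟶ Y),
      pullback.fst W.ι ι ≫ g = pullback.snd W.ι ι ≫ f := by
  have key {W : C.Opens} (hW : IsAffineOpen W) (hx : x ∈ W)
      (hinj : Function.Injective (C.presheaf.germ W x hx)) :
      ∃ l : Spec (.of (FractionRing (C.presheaf.stalk x))) ⟶ pullback W.ι ι,
        l ≫ pullback.fst W.ι ι = Spec.map (CommRingCat.ofHom (algebraMap (C.presheaf.stalk x)
          (FractionRing (C.presheaf.stalk x)))) ≫ W.fromSpecStalkOfMem x hx := by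
    have := isDominant_fromSpecStalk_fractionRing hW hx hinj
    have := isDominant_pullback_fst_of_isOpenImmersion W.ι ι
    have hne : (Set.range (pullback.fst W.ι ι)).Nonempty :=
      (pullback.fst W.ι ι).denseRange.nonempty_iff.mpr ⟨⟨x, hx⟩⟩ |>.elim fun p ↦ ⟨_, p, rfl⟩
    -- A dominant map from a one-point scheme meets the nonempty open `W ∩ X`, so it factors through
    -- it.
    obtain ⟨_, ⟨p, hp⟩, t, ht⟩ := (Spec.map (CommRingCat.ofHom (algebraMap (C.presheaf.stalk x)
      (FractionRing (C.presheaf.stalk x)))) ≫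
        W.fromSpecStalkOfMem x hx).denseRange.inter_open_nonempty _
        (pullback.fst W.ι ι).isOpenEmbedding.isOpen_range hne
    refine ⟨IsOpenImmersion.lift (pullback.fst W.ι ι) _ ?_, IsOpenImmersion.lift_fac _ _ _⟩
    rintro _ ⟨t', rfl⟩
    rw [Subsingleton.elim t' t, ht]
    exact ⟨p, hp⟩
  obtain ⟨W₀, hx₀, hW₀, hinj₀⟩ := C.exists_germ_injective x
  obtain ⟨l₀, hl₀⟩ := key hW₀ hx₀ hinj₀
  have hsq : CommSq (l₀ ≫ pullback.snd W₀.ι ι ≫ f)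
      (Spec.map (CommRingCat.ofHom (algebraMap (C.presheaf.stalk x)
          (FractionRing (C.presheaf.stalk x))))) sY (C.fromSpecStalk x ≫ sC) := ⟨by
    rw [Category.assoc, Category.assoc, hf, ← pullback.condition_assoc, reassoc_of% hl₀,
      Scheme.Opens.fromSpecStalkOfMem_ι_assoc]⟩
  obtain ⟨⟨⟨φ, hφ₁, hφ₂⟩⟩⟩ := (UniversallyClosed.eq_valuativeCriterion.le _ _ sY inferInstance).1
    { R := C.presheaf.stalk x, K := FractionRing (C.presheaf.stalk x), commSq := hsq, .. }
  obtain ⟨U, hxU, g, hg, hgS⟩ := spread_out_of_isGermInjective' sC sY φ hφ₂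
  -- The neighbourhood is shrunk so that germs at `x` are again injective; without this the fraction
  -- field point need not be dominant.
  obtain ⟨W, hxW, hW, hWU, hinj⟩ := C.exists_le_and_germ_injective x U hxU
  refine ⟨W, hxW, C.homOfLE hWU ≫ g, ?_⟩
  obtain ⟨l, hl⟩ := key hW hxW hinj
  have hdom : IsDominant l := by
    have := isDominant_fromSpecStalk_fractionRing hW hxW hinj
    rw [← hl] at this
    exact IsDominant.of_comp_isOpenImmersion _ (pullback.fst W.ι ι)
  have : IsReduced (pullback W.ι ι) :=
    isReduced_of_isOpenImmersion (pullback.fst W.ι ι)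
  refine ext_of_isDominant_of_isSeparated sY ?_ l ?_
  · rw [Category.assoc, Category.assoc, Category.assoc, hgS, hf, ← pullback.condition_assoc]
    simp
  · have h1 : W.fromSpecStalkOfMem x hxW ≫ C.homOfLE hWU = U.fromSpecStalkOfMem x hxU := by
      rw [← cancel_mono U.ι]
      simp
    have h2 : l ≫ pullback.snd W.ι ι = l₀ ≫ pullback.snd W₀.ι ι := by
      rw [← cancel_mono ι, Category.assoc, Category.assoc, ← pullback.condition,
        ← pullback.condition, reassoc_of% hl, reassoc_of% hl₀]
      simp
    rw [reassoc_of% hl, reassoc_of% h2, reassoc_of% h1, ← hg]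
    exact hφ₁

/-- Local extensions glue: on an overlap, which is reduced, both restrict to `f` on the dense trace
of `X`, and `Y` is separated. -/
theorem exists_extension {S X Y C : Scheme.{u}} [S.IsSeparated] (sC : C ⟶ S)
    [IsLocallyNoetherian C] [IsReduced C] (ι : X ⟶ C) [IsOpenImmersion ι] [IsDominant ι]
    (sY : Y ⟶ S) [IsProper sY] (f : X ⟶ Y) (hf : f ≫ sY = ι ≫ sC)
    (hC : ∀ x : C, IsDomain (C.presheaf.stalk x) ∧ IsPrincipalIdealRing (C.presheaf.stalk x)) :
    ∃ F : C ⟶ Y, ι ≫ F = f := by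
  have h (x : C) : ∃ (W : C.Opens) (_ : x ∈ W) (g : W.toScheme ⟶ Y),
      pullback.fst W.ι ι ≫ g = pullback.snd W.ι ι ≫ f := by
    have := (hC x).1
    have := (hC x).2
    exact exists_local_extension sC ι sY f hf x
  choose W hxW g hg using h
  have hg' (x : C) {P : Scheme.{u}} (a : P ⟶ W x) (c : P ⟶ X) (h : a ≫ (W x).ι = c ≫ ι) :
      a ≫ g x = c ≫ f := by
    have := congrArg (pullback.lift a c h ≫ ·) (hg x)
    simpa only [pullback.lift_fst_assoc, pullback.lift_snd_assoc] using this
  have hcov : TopologicalSpace.IsOpenCover W :=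
    top_le_iff.mp fun x _ ↦ TopologicalSpace.Opens.mem_iSup.mpr ⟨x, hxW x⟩
  have : Y.IsSeparated := ⟨by
    rw [← terminal.comp_from sY]
    infer_instance⟩
  let 𝒰 := C.openCoverOfIsOpenCover W hcov
  have hglue (x y : C) : pullback.fst (W x).ι (W y).ι ≫ g x =
      pullback.snd (W x).ι (W y).ι ≫ g y := by
    have : IsReduced (pullback (W x).ι (W y).ι) :=
      isReduced_of_isOpenImmersion (pullback.fst (W x).ι (W y).ι)
    have := isDominant_pullback_fst_of_isOpenImmersion
      (pullback.fst (W x).ι (W y).ι ≫ (W x).ι) ι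
    refine ext_of_isDominant (pullback.fst (pullback.fst (W x).ι (W y).ι ≫ (W x).ι) ι) ?_
    have h1 := hg' x (pullback.fst (pullback.fst (W x).ι (W y).ι ≫ (W x).ι) ι ≫
      pullback.fst (W x).ι (W y).ι) (pullback.snd _ ι) (by
        rw [Category.assoc]; exact pullback.condition)
    have h2 := hg' y (pullback.fst (pullback.fst (W x).ι (W y).ι ≫ (W x).ι) ι ≫
      pullback.snd (W x).ι (W y).ι) (pullback.snd _ ι) (by
        rw [Category.assoc, ← pullback.condition (f := (W x).ι)]; exact pullback.condition)
    rw [Category.assoc] at h1 h2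
    rw [h1, h2]
  refine ⟨𝒰.glueMorphisms g hglue, ?_⟩
  refine Scheme.Cover.hom_ext (𝒰.pullback₁ ι) _ _ fun (x : C) ↦ ?_
  change pullback.fst ι (𝒰.f x) ≫ ι ≫ 𝒰.glueMorphisms g hglue = pullback.fst ι (𝒰.f x) ≫ f
  rw [pullback.condition_assoc]
  exact (congrArg (pullback.snd ι (𝒰.f x) ≫ ·) (𝒰.ι_glueMorphisms g hglue x)).trans
    (hg' x _ _ pullback.condition.symm)

end AlgebraicGeometry

namespace AlgebraicGeometry

/-! ### Morphisms of curves -/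

theorem exists_germ_injective_of_le {C : Scheme.{u}} [IsLocallyNoetherian C] (x : C)
    (V : C.Opens) (hx : x ∈ V) : ∃ (W : C.Opens) (hxW : x ∈ W), IsAffineOpen W ∧ W ≤ V ∧
      Function.Injective (C.presheaf.germ W x hxW) :=
  C.exists_le_and_germ_injective x V hx

/-- The zero ideal of the stalk is the generic point of `W`, which belongs to every open set that
meets `W`. -/
theorem fromSpecStalk_mem_of_asIdeal_eq_bot {C : Scheme.{u}} {x : C} {W : C.Opens}
    (hW : IsAffineOpen W) (hx : x ∈ W) [IsDomain (C.presheaf.stalk x)]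
    (hinj : Function.Injective (C.presheaf.germ W x hx)) {p : Spec (C.presheaf.stalk x)}
    (hp : PrimeSpectrum.asIdeal p = ⊥) {O : C.Opens} (hO : (O ⊓ W : C.Opens) ≠ ⊥) :
    C.fromSpecStalk x p ∈ O := by
  have hdom := isDominant_fromSpecStalk_fractionRing hW hx hinj
  obtain ⟨z, hzO, hzW⟩ : ∃ z, z ∈ O ∧ z ∈ W := by
    by_contra! h
    exact hO (by ext z; simpa using h z)
  obtain ⟨_, hO', t, rfl⟩ := hdom.denseRange.inter_open_nonempty (W.ι ⁻¹ᵁ O : W.toScheme.Opens)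
    (W.ι ⁻¹ᵁ O).isOpen ⟨⟨z, hzW⟩, hzO⟩
  have hpt : p = Spec.map (CommRingCat.ofHom (algebraMap (C.presheaf.stalk x)
      (FractionRing (C.presheaf.stalk x)))) t := PrimeSpectrum.ext <| by
    refine hp.trans ((asIdeal_SpecMap_field _ _).trans ?_).symm
    exact (RingHom.injective_iff_ker_eq_bot _).mp (IsFractionRing.injective (C.presheaf.stalk x)
      (FractionRing (C.presheaf.stalk x)))
  rw [hpt, ← W.fromSpecStalkOfMem_ι x hx]
  exact hO'

/-- Generisations of `z` are primes of the stalk at `z`. A nonzero prime is maximal and gives `z`;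
the zero prime is generic near `z`, hence in the dense open `X`. -/
theorem eq_or_mem_range_of_specializes {X C : Scheme.{u}} [IsLocallyNoetherian C] (ι : X ⟶ C)
    [IsOpenImmersion ι] [IsDominant ι] {y z : C} [IsDomain (C.presheaf.stalk z)]
    [IsPrincipalIdealRing (C.presheaf.stalk z)] (h : y ⤳ z) : y = z ∨ y ∈ Set.range ι := by
  have hy : y ∈ Set.range (C.fromSpecStalk z) := by rwa [Scheme.range_fromSpecStalk]
  obtain ⟨p, rfl⟩ := hy
  by_cases hp : PrimeSpectrum.asIdeal p = ⊥
  · right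
    obtain ⟨W, hzW, hW, -, hinj⟩ := exists_germ_injective_of_le z ⊤ trivial
    refine fromSpecStalk_mem_of_asIdeal_eq_bot hW hzW hinj hp (O := ι.opensRange) fun hbot ↦ ?_
    obtain ⟨_, hvW, v, rfl⟩ := ι.denseRange.inter_open_nonempty W W.isOpen ⟨z, hzW⟩
    have : ι v ∈ (ι.opensRange ⊓ W : C.Opens) := ⟨⟨v, rfl⟩, hvW⟩
    rw [hbot] at this
    exact this
  · left
    have : (PrimeSpectrum.asIdeal p).IsPrime := p.isPrime
    have := IsPrime.to_maximal_ideal hp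
    have : p = IsLocalRing.closedPoint _ := PrimeSpectrum.ext (IsLocalRing.eq_maximalIdeal this)
    rw [this, Scheme.fromSpecStalk_closedPoint]

/-- The complement has finitely many irreducible components. The generic point of each is outside
`X`, so by `eq_or_mem_range_of_specializes` it has no proper specialisation, and the component is a
point. -/
theorem finite_compl_range {X C : Scheme.{u}} [IsNoetherian C] (ι : X ⟶ C)
    [IsOpenImmersion ι] [IsDominant ι]
    (hC : ∀ x : C, IsDomain (C.presheaf.stalk x) ∧ IsPrincipalIdealRing (C.presheaf.stalk x)) :
    (Set.range ι)ᶜ.Finite := by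
  obtain ⟨S, hS, hcl, hirr, hZ⟩ :=
    TopologicalSpace.NoetherianSpace.exists_finite_set_isClosed_irreducible
      ι.isOpenEmbedding.isOpen_range.isClosed_compl
  rw [hZ]
  refine hS.sUnion fun t ht ↦ ?_
  obtain ⟨y, hy⟩ := QuasiSober.sober (hirr t ht) (hcl t ht)
  refine (Set.finite_singleton y).subset fun z hz ↦ ?_
  have := (hC z).1
  have := (hC z).2
  refine ((eq_or_mem_range_of_specializes ι (hy.specializes hz)).resolve_right ?_).symm
  have : y ∈ (Set.range ι)ᶜ := hZ ▸ ⟨t, ht, hy.mem⟩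
  exact this

/-- The map from `X` to the preimage of `Y` is an open immersion with dense image. It is also
proper, so its image is closed, and it is an isomorphism. -/
theorem isPullback_of_isProper {X Y C D : Scheme.{u}} (ιX : X ⟶ C) [IsOpenImmersion ιX]
    [IsDominant ιX] (ιY : Y ⟶ D) [IsOpenImmersion ιY] (f : X ⟶ Y) [IsProper f] (F : C ⟶ D)
    [IsSeparated F] (h : ιX ≫ F = f ≫ ιY) : IsPullback ιX f F ιY := by
  let l : X ⟶ pullback F ιY := pullback.lift ιX f h
  have hl1 : l ≫ pullback.fst F ιY = ιX := pullback.lift_fst _ _ _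
  have hl2 : l ≫ pullback.snd F ιY = f := pullback.lift_snd _ _ _
  have : IsOpenImmersion (l ≫ pullback.fst F ιY) := hl1 ▸ inferInstance
  have : IsDominant (l ≫ pullback.fst F ιY) := hl1 ▸ inferInstance
  have : IsProper (l ≫ pullback.snd F ιY) := hl2 ▸ inferInstance
  have : IsOpenImmersion l := IsOpenImmersion.of_comp l (pullback.fst F ιY)
  have : IsDominant l := IsDominant.of_comp_isOpenImmersion l (pullback.fst F ιY)
  have : IsProper l := IsProper.of_comp l (pullback.snd F ιY)
  have : Surjective l := ⟨Set.range_eq_univ.mp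
    (l.isClosedMap.isClosed_range.closure_eq ▸ l.denseRange.closure_eq)⟩
  have : IsIso l := (isIso_iff_isOpenImmersion_and_surjective _).mpr ⟨inferInstance, inferInstance⟩
  exact IsPullback.of_iso_pullback ⟨h⟩ (asIso l) hl1 hl2

/-- A fibre consists of points of a fibre of `f` and of points of the finite complement of `X`; a
proper morphism with finite fibres is finite. -/
theorem isFinite_of_isProper {X Y C D : Scheme.{u}} [IsNoetherian C] (ιX : X ⟶ C)
    [IsOpenImmersion ιX] [IsDominant ιX]
    (hC : ∀ x : C, IsDomain (C.presheaf.stalk x) ∧ IsPrincipalIdealRing (C.presheaf.stalk x))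
    (ιY : Y ⟶ D) [IsOpenImmersion ιY] (f : X ⟶ Y) [IsFinite f] (F : C ⟶ D)
    [IsProper F] (h : ιX ≫ F = f ≫ ιY) : IsFinite F := by
  have : LocallyQuasiFinite F := locallyQuasiFinite_iff_finite_preimage_singleton.mpr fun y ↦ by
    have hfin : ((f ≫ ιY) ⁻¹' {y}).Finite := by
      rw [Scheme.Hom.comp_base, TopCat.coe_comp, Set.preimage_comp]
      exact (Set.subsingleton_singleton.preimage ιY.injective).finite.preimage' fun y _ ↦
        f.finite_preimage_singleton y
    refine ((finite_compl_range ιX hC).union (hfin.image ιX)).subset fun z hz ↦ ?_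
    by_cases hzX : z ∈ Set.range ιX
    · obtain ⟨x, rfl⟩ := hzX
      refine Or.inr ⟨x, ?_, rfl⟩
      rwa [← h]
    · exact Or.inl hzX
  exact IsFinite.of_isProper_of_locallyQuasiFinite F

/-- Suppose a nonzero section `s` near `F x` becomes zero on a neighbourhood `W` of `x`. The image
of `W ∩ X` is open because `f` is open, so it contains the generic point near `F x`, where `s` is
invertible. This is a contradiction. -/
theorem stalkMap_injective {X Y C D : Scheme.{u}} [IsLocallyNoetherian D] [IsReduced D]
    (ιX : X ⟶ C) [IsOpenImmersion ιX] [IsDominant ιX]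
    (ιY : Y ⟶ D) [IsOpenImmersion ιY] (f : X ⟶ Y) (hf : IsOpenMap f) (F : C ⟶ D)
    (h : ιX ≫ F = f ≫ ιY) (x : C) [IsDomain (D.presheaf.stalk (F x))] :
    Function.Injective (F.stalkMap x) := by
  rw [injective_iff_map_eq_zero]
  intro a ha
  by_contra hne
  obtain ⟨V₀, hV₀, s₀, rfl⟩ := D.presheaf.exists_germ_eq a
  obtain ⟨V, hxV, hV, hVV, hinj⟩ := exists_germ_injective_of_le (F x) V₀ hV₀
  let s := D.presheaf.map (homOfLE hVV).op s₀
  have hs : D.presheaf.germ V (F x) hxV s = D.presheaf.germ V₀ (F x) hV₀ s₀ :=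
    D.presheaf.germ_res_apply _ _ _ _
  rw [← hs] at ha hne
  have hs0 : s ≠ 0 := fun h0 ↦ hne (by rw [h0, map_zero])
  rw [Scheme.Hom.germ_stalkMap_apply] at ha
  obtain ⟨W, hxW, i, i', hW⟩ := C.presheaf.germ_eq x hxV (V := F ⁻¹ᵁ V) hxV _ 0
    (ha.trans (map_zero _).symm)
  rw [map_zero] at hW
  obtain ⟨η, hη⟩ : ∃ η, ∀ O : D.Opens, (O ⊓ V : D.Opens) ≠ ⊥ → η ∈ O :=
    ⟨_, fun O hO ↦ fromSpecStalk_mem_of_asIdeal_eq_bot hV hxV hinj (p := ⟨⊥, Ideal.isPrime_bot⟩)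
      rfl hO⟩
  have h1 : η ∈ D.basicOpen s := hη _ (by
    rw [inf_of_le_left (D.basicOpen_le s), ne_eq, basicOpen_eq_bot_iff]
    exact hs0)
  let O : D.Opens := ⟨(f ≫ ιY) '' (ιX ⁻¹ᵁ W), by
    rw [Scheme.Hom.comp_base, TopCat.coe_comp]
    exact (ιY.isOpenEmbedding.isOpenMap.comp hf) _ (ιX ⁻¹ᵁ W).isOpen⟩
  have h2 : η ∈ O := by
    refine hη _ fun hbot ↦ ?_
    obtain ⟨_, hwW, w, rfl⟩ := ιX.denseRange.inter_open_nonempty W W.isOpen ⟨x, hxW⟩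
    have : (f ≫ ιY) w ∈ (O ⊓ V : D.Opens) := ⟨⟨w, hwW, rfl⟩, by
      rw [← h]
      exact i.le hwW⟩
    rw [hbot] at this
    exact this
  obtain ⟨w, hwW, rfl⟩ := h2
  rw [← h] at h1
  have h3 : ιX w ∈ F ⁻¹ᵁ D.basicOpen s := h1
  rw [Scheme.preimage_basicOpen] at h3
  have h4 : ιX w ∈ C.basicOpen (C.presheaf.map i.op (F.app V s)) := by
    rw [Scheme.basicOpen_res]
    exact ⟨hwW, h3⟩
  rw [hW, Scheme.basicOpen_zero] at h4
  exact h4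

/-- The stalk maps are injections of a principal ideal domain into a domain, so the target is
torsion-free and therefore flat. -/
theorem flat_of_isOpenMap {X Y C D : Scheme.{u}} [IsLocallyNoetherian D] [IsReduced D]
    (ιX : X ⟶ C) [IsOpenImmersion ιX] [IsDominant ιX]
    (hC : ∀ x : C, IsDomain (C.presheaf.stalk x))
    (hD : ∀ x : D, IsDomain (D.presheaf.stalk x) ∧ IsPrincipalIdealRing (D.presheaf.stalk x))
    (ιY : Y ⟶ D) [IsOpenImmersion ιY] (f : X ⟶ Y) (hf : IsOpenMap f) (F : C ⟶ D)
    (h : ιX ≫ F = f ≫ ιY) : Flat F := by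
  refine Flat.of_stalkMap F fun x ↦ ?_
  have := hC x
  have := (hD (F x)).1
  have := (hD (F x)).2
  have hinj := stalkMap_injective ιX ιY f hf F h x
  algebraize [(F.stalkMap x).hom]
  have : FaithfulSMul (D.presheaf.stalk (F x)) (C.presheaf.stalk x) :=
    (faithfulSMul_iff_algebraMap_injective _ _).mpr hinj
  have : Module.IsTorsionFree (D.presheaf.stalk (F x)) (C.presheaf.stalk x) := inferInstance
  change Module.Flat (D.presheaf.stalk (F x)) (C.presheaf.stalk x)
  infer_instance

/-- The degree is locally constant, so each value that it takes is taken on the dense open `Y`,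
where base change gives the degree of `f`. -/
theorem finrank_eq_of_isPullback {X Y C D : Scheme.{u}} [IsLocallyNoetherian D] {ιX : X ⟶ C}
    {ιY : Y ⟶ D} [IsDominant ιY] {f : X ⟶ Y} {F : C ⟶ D} (h : IsPullback ιX f F ιY) [IsFinite F]
    [Flat F] {d : ℕ} (hd : ∀ y, f.finrank y = d) (y : D) : F.finrank y = d := by
  have hloc := Scheme.Hom.isLocallyConstant_finrank F
  obtain ⟨_, hz, z, rfl⟩ := ιY.denseRange.inter_open_nonempty _ (hloc.isOpen_fiber (F.finrank y))
    ⟨y, rfl⟩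
  rw [← hd z, Scheme.Hom.finrank_of_isPullback _ _ _ _ h]
  exact hz.symm

end AlgebraicGeometry

/-! ### Regular compactifications of curves -/

namespace RegularCompactification

variable {k : Type u} [Field k] {X Y : Scheme.{u}} {sX : X ⟶ Spec (.of k)} {sY : Y ⟶ Spec (.of k)}

theorem isNoetherian (C : RegularCompactification sX) : IsNoetherian C.C :=
  have := C.isProper
  have : CompactSpace C.C := QuasiCompact.compactSpace_of_compactSpace C.str
  { __ := LocallyOfFiniteType.isLocallyNoetherian C.str }

theorem isSeparated (C : RegularCompactification sX) : C.C.IsSeparated := ⟨by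
  have := C.isProper
  rw [← terminal.comp_from C.str]
  infer_instance⟩

theorem isDomain_and_isPrincipalIdealRing_stalk (C : RegularCompactification sX)
    [SmoothOfRelativeDimension 1 sX] (x : C.C) :
    IsDomain (C.C.presheaf.stalk x) ∧ IsPrincipalIdealRing (C.C.presheaf.stalk x) := by
  have := C.isProper
  have := C.isOpenImmersion
  have := C.isDominant
  have := C.isRegular x
  have : SmoothOfRelativeDimension 1 (C.ι ≫ C.str) := by rwa [C.ι_str]
  have h := ringKrullDim_stalk_le_one C.str C.ι x
  have := IsRegularLocalRing.isDomain_of_ringKrullDim_le_one h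
  exact ⟨this, IsRegularLocalRing.isPrincipalIdealRing_of_ringKrullDim_le_one h⟩

theorem isReduced (C : RegularCompactification sX) [SmoothOfRelativeDimension 1 sX] :
    IsReduced C.C :=
  have (x : C.C) : _root_.IsReduced (C.C.presheaf.stalk x) :=
    have := (C.isDomain_and_isPrincipalIdealRing_stalk x).1
    inferInstance
  isReduced_of_isReduced_stalk C.C

theorem hom_ext (CX : RegularCompactification sX) [SmoothOfRelativeDimension 1 sX]
    {Z : Scheme.{u}} [Z.IsSeparated] {F G : CX.C ⟶ Z} (h : CX.ι ≫ F = CX.ι ≫ G) : F = G :=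
  have := CX.isReduced
  have := CX.isDominant
  ext_of_isDominant CX.ι h

theorem exists_extension (CX : RegularCompactification sX) [SmoothOfRelativeDimension 1 sX]
    (CY : RegularCompactification sY) (f : X ⟶ Y) (hf : f ≫ sY = sX) :
    ∃ F : CX.C ⟶ CY.C, CX.ι ≫ F = f ≫ CY.ι := by
  have := CX.isReduced
  have := CX.isNoetherian
  have := CX.isDominant
  have := CX.isOpenImmersion
  have := CY.isProper
  refine AlgebraicGeometry.exists_extension CX.str CX.ι CY.str (f ≫ CY.ι) ?_
    CX.isDomain_and_isPrincipalIdealRing_stalk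
  rw [Category.assoc, CY.ι_str, CX.ι_str, hf]

theorem isProper_extension (CX : RegularCompactification sX) [SmoothOfRelativeDimension 1 sX]
    (CY : RegularCompactification sY) (f : X ⟶ Y) (hf : f ≫ sY = sX) {F : CX.C ⟶ CY.C}
    (hF : CX.ι ≫ F = f ≫ CY.ι) : IsProper F := by
  have h : F ≫ CY.str = CX.str := CX.hom_ext (by
    rw [reassoc_of% hF, CY.ι_str, CX.ι_str, hf])
  have := CX.isProper
  have := CY.isProper
  have : IsProper (F ≫ CY.str) := h ▸ inferInstance
  exact IsProper.of_comp F CY.str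

theorem isPullback_extension (CX : RegularCompactification sX) [SmoothOfRelativeDimension 1 sX]
    (CY : RegularCompactification sY) (f : X ⟶ Y) [IsFinite f] (hf : f ≫ sY = sX)
    {F : CX.C ⟶ CY.C} (hF : CX.ι ≫ F = f ≫ CY.ι) : IsPullback CX.ι f F CY.ι := by
  have := CX.isProper_extension CY f hf hF
  have := CX.isDominant
  have := CX.isOpenImmersion
  have := CY.isOpenImmersion
  exact isPullback_of_isProper CX.ι CY.ι f F hF

theorem isFiniteOfDegree_extension (CX : RegularCompactification sX)
    [SmoothOfRelativeDimension 1 sX] (CY : RegularCompactification sY)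
    [SmoothOfRelativeDimension 1 sY] (f : X ⟶ Y) [IsFinite f] [Etale f] (hf : f ≫ sY = sX)
    {F : CX.C ⟶ CY.C} (hF : CX.ι ≫ F = f ≫ CY.ι) {d : ℚ}
    (hd : ∀ y, (f.finrank y : ℚ) = d) :
    IsFiniteOfDegree F d := by
  have := CX.isProper_extension CY f hf hF
  have := CX.isDominant
  have := CX.isOpenImmersion
  have := CY.isOpenImmersion
  have := CY.isDominant
  have := CX.isNoetherian
  have := CY.isNoetherian
  have := CY.isReduced
  have hfin : IsFinite F := isFinite_of_isProper CX.ι CX.isDomain_and_isPrincipalIdealRing_stalk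
    CY.ι f F hF
  have hflat : Flat F := flat_of_isOpenMap CX.ι
    (fun x ↦ (CX.isDomain_and_isPrincipalIdealRing_stalk x).1)
    CY.isDomain_and_isPrincipalIdealRing_stalk CY.ι f f.isOpenMap F hF
  refine ⟨hfin, hflat, fun y ↦ ?_⟩
  -- The rational number `d` is known to be a natural number only once `Y` has a point. If `Y` is
  -- empty, so is its compactification, and any `d` is allowed; this covers `b = 0`.
  obtain ⟨_, -, y₀, rfl⟩ := CY.ι.denseRange.inter_open_nonempty Set.univ isOpen_univ ⟨y, trivial⟩
  rw [finrank_eq_of_isPullback (CX.isPullback_extension CY f hf hF) (d := f.finrank y₀) fun z ↦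
    Nat.cast_injective (R := ℚ) ((hd z).trans (hd y₀).symm), hd]

end RegularCompactification

namespace AlgebraicGeometry

/-! ### Finite étale schemes over a separably closed field -/

/-- A section of an étale morphism is étale and a monomorphism. -/
theorem isOpenImmersion_of_section {S P : Scheme.{u}} {p : P ⟶ S} [Etale p] {σ : S ⟶ P}
    (hσ : σ ≫ p = 𝟙 S) : IsOpenImmersion σ := by
  have : Etale (σ ≫ p) := hσ ▸ inferInstance
  have : Etale σ := Etale.of_comp σ p
  have : Mono σ := ⟨fun f g h ↦ by simpa [hσ] using congrArg (· ≫ p) h⟩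
  exact IsOpenImmersion.of_flat_of_mono σ

variable {K : Type u} [Field K] {P : Scheme.{u}} {p : P ⟶ Spec (.of K)}

theorem section_ext [Etale p] {σ τ : Spec (.of K) ⟶ P} (hσ : σ ≫ p = 𝟙 _) (hτ : τ ≫ p = 𝟙 _)
    {x y : Spec (.of K)} (h : σ x = τ y) : σ = τ := by
  have := isOpenImmersion_of_section hσ
  have := isOpenImmersion_of_section hτ
  have hr : Set.range σ ⊆ Set.range τ := by
    rintro _ ⟨z, rfl⟩
    exact ⟨y, by rw [← h, Subsingleton.elim z x]⟩
  have hl := IsOpenImmersion.lift_fac τ σ hr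
  have : IsOpenImmersion.lift τ σ hr = 𝟙 _ := by
    rw [← hl, Category.assoc, hτ, Category.comp_id] at hσ
    exact hσ
  rw [← hl, this, Category.id_comp]

variable [IsSepClosed K]

theorem exists_section [Etale p] (x : P) : ∃ σ : Spec (.of K) ⟶ P, σ ≫ p = 𝟙 _ ∧ σ default = x :=
  Scheme.exists_fac_of_etale_of_isSepClosed p (𝟙 _) x (Subsingleton.elim _ _)

/-- Sections are open immersions with pairwise disjoint images. They cover `P`, since over a
separably closed field each point of an étale scheme is the image of a section. -/
theorem isIso_sigmaDesc_sections [Etale p] {I : Type u} {σ : I → (Spec (.of K) ⟶ P)}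
    (hσ : ∀ i, σ i ≫ p = 𝟙 _) (hinj : Function.Injective σ)
    (hsurj : ∀ τ : Spec (.of K) ⟶ P, τ ≫ p = 𝟙 _ → ∃ i, σ i = τ) : IsIso (Sigma.desc σ) := by
  have (i : I) := isOpenImmersion_of_section (hσ i)
  have : IsOpenImmersion (Sigma.desc σ) := by
    refine isOpenImmersion_sigmaDesc _ _ fun i j hij ↦ ?_
    refine Set.disjoint_left.mpr ?_
    rintro _ ⟨x, rfl⟩ ⟨y, hy⟩
    exact hij (hinj (section_ext (hσ i) (hσ j) hy.symm))
  have : Surjective (Sigma.desc σ) := ⟨fun x ↦ by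
    obtain ⟨τ, hτ, rfl⟩ := exists_section (p := p) x
    obtain ⟨i, rfl⟩ := hsurj τ hτ
    exact ⟨Sigma.ι (fun _ : I ↦ Spec (.of K)) i default, by
      rw [← Scheme.Hom.comp_apply, Sigma.ι_desc]⟩⟩
  exact (isIso_iff_isOpenImmersion_and_surjective _).mpr ⟨inferInstance, inferInstance⟩

/-- A finite étale algebra over a separably closed field is a product of copies of the field,
indexed by its spectrum. -/
theorem natCard_eq_finrank [IsFinite p] [Etale p] (y : Spec (.of K)) :
    Nat.card P = p.finrank y := by
  have : IsAffine P := isAffine_of_isAffineHom p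
  let ψ : CommRingCat.of K ⟶ Γ(P, ⊤) := Spec.preimage (P.isoSpec.inv ≫ p)
  have hψ : Spec.map ψ = P.isoSpec.inv ≫ p := Spec.map_preimage _
  have hp : p = P.isoSpec.hom ≫ Spec.map ψ := by rw [hψ, Iso.hom_inv_id_assoc]
  have h1 : ψ.hom.Finite := by
    rw [← IsFinite.SpecMap_iff, hψ]
    infer_instance
  have h2 : ψ.hom.Etale := by
    rw [← HasRingHomProperty.Spec_iff (P := @Etale), hψ]
    infer_instance
  algebraize [ψ.hom]
  have : Flat (Spec.map ψ) := by rw [hψ]; infer_instance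
  have : IsFinite (Spec.map ψ) := by rw [hψ]; infer_instance
  rw [hp, Scheme.Hom.finrank_comp_left_of_isIso]
  have h3 := Scheme.Hom.finrank_SpecMap_algebraMap K Γ(P, ⊤) y
  refine Eq.trans ?_ h3.symm
  rw [Module.rankAtStalk_eq_finrank_of_free,
    (Algebra.FormallyEtale.equivPiOfIsSepClosed K Γ(P, ⊤)).toLinearEquiv.finrank_eq]
  have : Finite (PrimeSpectrum Γ(P, ⊤)) := by
    have : IsArtinianRing Γ(P, ⊤) := isArtinian_of_tower K inferInstance
    infer_instance
  have := Fintype.ofFinite (PrimeSpectrum Γ(P, ⊤))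
  rw [Module.finrank_fintype_fun_eq_card, ← Nat.card_eq_fintype_card]
  exact Nat.card_congr (P.isoSpec.hom.homeomorph).toEquiv

theorem natCard_sections_eq_finrank [IsFinite p] [Etale p] (y : Spec (.of K)) :
    Nat.card {σ : Spec (.of K) ⟶ P // σ ≫ p = 𝟙 _} = p.finrank y := by
  rw [← natCard_eq_finrank y]
  refine Nat.card_congr (Equiv.ofBijective (fun σ ↦ σ.1 default) ⟨fun σ τ h ↦ ?_, fun x ↦ ?_⟩)
  · exact Subtype.ext (section_ext σ.2 τ.2 h)
  · obtain ⟨σ, hσ, h⟩ := exists_section (p := p) x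
    exact ⟨⟨σ, hσ⟩, h⟩

theorem natCard_lifts_eq_finrank {X Y : Scheme.{u}} (f : X ⟶ Y) [IsFinite f] [Etale f]
    (a : Spec (.of K) ⟶ Y) :
    Nat.card {x : Spec (.of K) ⟶ X // x ≫ f = a} = f.finrank (a default) := by
  rw [← Scheme.Hom.finrank_pullback_snd f a, ← natCard_sections_eq_finrank]
  exact Nat.card_congr
    { toFun x := ⟨pullback.lift x.1 (𝟙 _) (by rw [x.2, Category.id_comp]), pullback.lift_snd _ _ _⟩
      invFun σ := ⟨σ.1 ≫ pullback.fst f a, by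
        rw [Category.assoc, pullback.condition, reassoc_of% σ.2]⟩
      left_inv x := Subtype.ext (pullback.lift_fst _ _ _)
      right_inv σ := Subtype.ext (by
        refine pullback.hom_ext (pullback.lift_fst _ _ _) ?_
        rw [σ.2]
        exact pullback.lift_snd _ _ _) }

theorem exists_geometric_point {Y : Scheme.{u}} (y : Y) :
    ∃ (L : Type u) (_ : Field L) (_ : IsSepClosed L) (a : Spec (.of L) ⟶ Y), a default = y :=
  ⟨AlgebraicClosure (Y.residueField y), inferInstance, inferInstance,
    Spec.map (CommRingCat.ofHom (algebraMap (Y.residueField y) _)) ≫ Y.fromSpecResidueField y,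
    Y.fromSpecResidueField_apply y _⟩

end AlgebraicGeometry

/-! ### Points of sites -/

namespace CategoryTheory.GrothendieckTopology.Point

universe w v' u'

variable {C : Type u'} [Category.{v'} C] {J : GrothendieckTopology C} (Φ : Point.{w} J)

theorem exists_common_refinement {X Y : C} (x : Φ.fiber.obj X) (y : Φ.fiber.obj Y) :
    ∃ (Z : C) (z : Φ.fiber.obj Z) (f : Z ⟶ X) (g : Z ⟶ Y),
      Φ.fiber.map f z = x ∧ Φ.fiber.map g z = y := by
  obtain ⟨⟨Z, z⟩, ⟨f, hf⟩, ⟨g, hg⟩, -⟩ :=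
    IsCofilteredOrEmpty.cone_objs (C := Φ.fiber.Elements) ⟨X, x⟩ ⟨Y, y⟩
  exact ⟨Z, z, f, g, hf, hg⟩

theorem exists_equalizing {X Y : C} (f g : X ⟶ Y) (x : Φ.fiber.obj X)
    (h : Φ.fiber.map f x = Φ.fiber.map g x) :
    ∃ (Z : C) (z : Φ.fiber.obj Z) (e : Z ⟶ X), Φ.fiber.map e z = x ∧ e ≫ f = e ≫ g := by
  obtain ⟨⟨Z, z⟩, ⟨e, he⟩, h'⟩ := IsCofilteredOrEmpty.cone_maps (C := Φ.fiber.Elements)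
    (X := ⟨X, x⟩) (Y := ⟨Y, Φ.fiber.map f x⟩) (CategoryOfElements.homMk _ _ f rfl)
    (CategoryOfElements.homMk _ _ g h.symm)
  exact ⟨Z, z, e, he, congrArg Subtype.val h'⟩

theorem toPresheafFiber_eq_of_map_eq {A : Type*} [Category* A] [HasColimitsOfSize.{w, w} A]
    {FC : A → A → Type*} {CC : A → Type*} [∀ X Y : A, FunLike (FC X Y) (CC X) (CC Y)]
    [ConcreteCategory A FC] {X X' Y Z : C} (f : Y ⟶ X) (f' : Y ⟶ X') (g : Z ⟶ Y)
    (z : Φ.fiber.obj Z) (P : Cᵒᵖ ⥤ A) (v : ToType (P.obj (op X))) (v' : ToType (P.obj (op X')))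
    (h : P.map g.op (P.map f.op v) = P.map g.op (P.map f'.op v')) :
    Φ.toPresheafFiber X (Φ.fiber.map f (Φ.fiber.map g z)) P v =
      Φ.toPresheafFiber X' (Φ.fiber.map f' (Φ.fiber.map g z)) P v' := by
  simp only [← toPresheafFiber_w_apply, h]

end CategoryTheory.GrothendieckTopology.Point

/-! ### Stalks of projectivisations -/

section

variable {U : Scheme.{u}} {ℓ n : ℕ} {K : Type u} [Field K] [IsSepClosed K]
  {F : Sheaf U.smallEtaleTopology (ModuleCat.{u} (ZMod (ℓ ^ n)))} {a : Spec (.of K) ⟶ U}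

theorem StarSections.germ_res {T T' : U.Etale} (f : T' ⟶ T)
    (t : (Scheme.pointSmallEtale a).fiber.obj T') (v : StarSections F.obj T) :
    (StarSections.res F.obj f v).germ t =
      v.germ ((Scheme.pointSmallEtale a).fiber.map f t) :=
  Subtype.ext ((Scheme.pointSmallEtale a).toPresheafFiber_w_apply f t F.obj v.1)

theorem StarSections.germ_smul {T : U.Etale} (t : (Scheme.pointSmallEtale a).fiber.obj T)
    (c : (ZMod (ℓ ^ n))ˣ) (v : StarSections F.obj T) : (c • v).germ t = c • v.germ t :=
  Subtype.ext (map_smul ((Scheme.pointSmallEtale a).toPresheafFiber T t F.obj).hom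
    (c : ZMod (ℓ ^ n)) v.1)

theorem map_projClass {T T' : U.Etale} (f : T' ⟶ T) (v : StarSections F.obj T) :
    (projSheaf F).obj.map f.op (projClass F v) = projClass F (StarSections.res F.obj f v) :=
  (ConcreteCategory.congr_hom ((toSheafify U.smallEtaleTopology (projPresheaf F.obj)).naturality
    f.op) (Quotient.mk (MulAction.orbitRel (ZMod (ℓ ^ n))ˣ (StarSections F.obj T)) v)).symm

theorem projClass_smul {T : U.Etale} (c : (ZMod (ℓ ^ n))ˣ) (v : StarSections F.obj T) :
    projClass F (c • v) = projClass F v :=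
  congrArg ((toSheafify U.smallEtaleTopology (projPresheaf F.obj)).app (op T))
    (Quotient.sound (s := MulAction.orbitRel (ZMod (ℓ ^ n))ˣ (StarSections F.obj T)) ⟨c, rfl⟩)

theorem ModProj.mk_smul {M : Type*} [AddCommGroup M] [Module (ZMod (ℓ ^ n)) M]
    (c : (ZMod (ℓ ^ n))ˣ) (v : ModStar ℓ n M) : ModProj.mk (c • v) = ModProj.mk v :=
  Quotient.sound (s := MulAction.orbitRel (ZMod (ℓ ^ n))ˣ (ModStar ℓ n M)) ⟨c, rfl⟩

theorem ModProj.exists_smul_of_mk_eq {M : Type*} [AddCommGroup M] [Module (ZMod (ℓ ^ n)) M]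
    {v w : ModStar ℓ n M} (h : ModProj.mk v = ModProj.mk w) : ∃ c : (ZMod (ℓ ^ n))ˣ, c • w = v :=
  Quotient.exact (s := MulAction.orbitRel (ZMod (ℓ ^ n))ˣ (ModStar ℓ n M)) h

variable {X : U.Etale} (hX : (projSheaf F).obj.RepresentableBy X)

/-- The point of the representing scheme given by a section of `𝒱^*` near a geometric point. -/
noncomputable def projPoint {T : U.Etale} (t : (Scheme.pointSmallEtale a).fiber.obj T)
    (v : StarSections F.obj T) : (Scheme.pointSmallEtale a).fiber.obj X :=
  (Scheme.pointSmallEtale a).fiber.map (hX.homEquiv.symm (projClass F v)) t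

theorem projPoint_res {T T' : U.Etale} (f : T' ⟶ T)
    (t : (Scheme.pointSmallEtale a).fiber.obj T') (v : StarSections F.obj T) :
    projPoint hX t (StarSections.res F.obj f v) =
      projPoint hX ((Scheme.pointSmallEtale a).fiber.map f t) v := by
  rw [projPoint, projPoint, ← map_projClass, ← hX.comp_homEquiv_symm]
  exact ConcreteCategory.congr_hom ((Scheme.pointSmallEtale a).fiber.map_comp f _) t

/-- If the points agree, the two morphisms to `X` agree on a smaller neighbourhood, so the two
classes agree in the sheafification. They then agree in the presheaf after further shrinking, that
is, up to a unit. Conversely, an equality of germs up to a unit holds on a neighbourhood. -/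
theorem projPoint_eq_iff_of_same {T : U.Etale} (t : (Scheme.pointSmallEtale a).fiber.obj T)
    (v w : StarSections F.obj T) :
    projPoint hX t v = projPoint hX t w ↔ ModProj.mk (v.germ t) = ModProj.mk (w.germ t) := by
  constructor
  · intro h
    obtain ⟨T₁, t₁, f, rfl, hf⟩ := (Scheme.pointSmallEtale a).exists_equalizing _ _ t h
    rw [hX.comp_homEquiv_symm, hX.comp_homEquiv_symm, map_projClass, map_projClass] at hf
    have h₁ := Presheaf.equalizerSieve_mem U.smallEtaleTopology
      (toSheafify U.smallEtaleTopology (projPresheaf F.obj)) _ _ (hX.homEquiv.symm.injective hf)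
    obtain ⟨T₂, g, hg, t₂, rfl⟩ := (Scheme.pointSmallEtale a).jointly_surjective _ h₁ t₁
    obtain ⟨c, hc⟩ := Quotient.exact
      (s := MulAction.orbitRel (ZMod (ℓ ^ n))ˣ (StarSections F.obj T₂)) hg
    rw [← StarSections.germ_res, ← StarSections.germ_res, ← StarSections.germ_res,
      ← StarSections.germ_res]
    exact (congrArg (fun z ↦ ModProj.mk (StarSections.germ t₂ z)) hc).symm.trans
      ((congrArg ModProj.mk (StarSections.germ_smul t₂ c _)).trans (ModProj.mk_smul c _))
  · intro h
    obtain ⟨c, hc⟩ := ModProj.exists_smul_of_mk_eq h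
    rw [← StarSections.germ_smul] at hc
    obtain ⟨T₁, f, t₁, rfl, hf⟩ :=
      ((Scheme.pointSmallEtale a).toPresheafFiber_eq_iff' _ _ _ _).mp (congrArg Subtype.val hc)
    have hf' : StarSections.res F.obj f v = c • StarSections.res F.obj f w := by
      rw [← StarSections.res_smul]
      exact Subtype.ext hf.symm
    rw [← projPoint_res, ← projPoint_res, hf', projPoint, projClass_smul]
    rfl

theorem projPoint_eq_iff {T T' : U.Etale} (t : (Scheme.pointSmallEtale a).fiber.obj T)
    (t' : (Scheme.pointSmallEtale a).fiber.obj T') (v : StarSections F.obj T)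
    (w : StarSections F.obj T') :
    projPoint hX t v = projPoint hX t' w ↔ ModProj.mk (v.germ t) = ModProj.mk (w.germ t') := by
  obtain ⟨T₁, t₁, f, g, rfl, rfl⟩ := (Scheme.pointSmallEtale a).exists_common_refinement t t'
  rw [← projPoint_res, ← projPoint_res, ← StarSections.germ_res, ← StarSections.germ_res]
  exact projPoint_eq_iff_of_same hX t₁ _ _

/-- The universal section over `X` is locally the class of a section of `𝒱^*`; this is applied on a
neighbourhood of `x`. -/
theorem projPoint_surjective (x : (Scheme.pointSmallEtale a).fiber.obj X) :
    ∃ (T : U.Etale) (t : (Scheme.pointSmallEtale a).fiber.obj T) (v : StarSections F.obj T),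
      projPoint hX t v = x := by
  have h := Presheaf.imageSieve_mem U.smallEtaleTopology
    (toSheafify U.smallEtaleTopology (projPresheaf F.obj)) (U := op X) (hX.homEquiv (𝟙 X))
  obtain ⟨T, f, ⟨q, hq⟩, t, rfl⟩ := (Scheme.pointSmallEtale a).jointly_surjective _ h x
  induction q using Quotient.inductionOn with | _ v =>
  refine ⟨T, t, v, ?_⟩
  have hv : projClass F v = hX.homEquiv f := by
    refine hq.trans ?_
    exact (hX.homEquiv_comp f (𝟙 X)).symm.trans (by rw [Category.comp_id])
  rw [projPoint, hv, Equiv.symm_apply_apply]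

end

/-! ### Stalks of locally constant sheaves -/

section

variable {U : Scheme.{u}} {ℓ n b : ℕ}
  {F : Sheaf U.smallEtaleTopology (ModuleCat.{u} (ZMod (ℓ ^ n)))}

/-- A family of sections of `F` over `T` that is a basis of each stalk. -/
def IsTrivialization {T : U.Etale}
    (β : (Fin b → ZMod (ℓ ^ n)) →ₗ[ZMod (ℓ ^ n)] F.obj.obj (op T)) : Prop :=
  ∀ (K : Type u) [Field K] [IsSepClosed K] (a : Spec (.of K) ⟶ U)
    (t : (Scheme.pointSmallEtale a).fiber.obj T),
    Function.Bijective fun c ↦ (Scheme.pointSmallEtale a).toPresheafFiber T t F.obj (β c)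

/-- Locally bijective morphisms are bijective on stalks. This replaces a morphism of presheaves on
the site over `T` by one linear map into the sections over `T`. -/
theorem IsLocallyConstantFree.exists_isTrivialization (hF : IsLocallyConstantFree b F) :
    ∃ S ∈ U.smallEtaleTopology (Scheme.Etale.mk (𝟙 U)),
      ∀ ⦃T : U.Etale⦄ (f : T ⟶ Scheme.Etale.mk (𝟙 U)), S f →
        ∃ β : (Fin b → ZMod (ℓ ^ n)) →ₗ[ZMod (ℓ ^ n)] F.obj.obj (op T), IsTrivialization β := by
  obtain ⟨S, hS, h⟩ := hF
  refine ⟨S, hS, fun T f hf ↦ ?_⟩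
  obtain ⟨α, hinj, hsurj⟩ := h f hf
  -- The source of `α` is a constant presheaf, so `α` is determined by its value over `T` itself.
  have hα {T' : U.Etale} (g : T' ⟶ T) (m : ULift.{u} (Fin b → ZMod (ℓ ^ n))) :
      F.obj.map g.op (α.app (op (Over.mk (𝟙 T))) m) = α.app (op (Over.mk g)) m :=
    (ConcreteCategory.congr_hom
      (α.naturality (Over.homMk g : Over.mk g ⟶ Over.mk (𝟙 T)).op) m).symm
  refine ⟨(α.app (op (Over.mk (𝟙 T)))).hom ∘ₗ ULift.moduleEquiv.symm.toLinearMap, ?_⟩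
  intro K _ _ a t
  constructor
  · intro c c' hc
    obtain ⟨T₁, g, t₁, rfl, hg⟩ :=
      ((Scheme.pointSmallEtale a).toPresheafFiber_eq_iff' _ _ _ _).mp hc
    have hg' : α.app (op (Over.mk g)) ⟨c⟩ = α.app (op (Over.mk g)) ⟨c'⟩ :=
      (hα g ⟨c⟩).symm.trans (hg.trans (hα g ⟨c'⟩))
    have h₁ := Presheaf.equalizerSieve_mem (U.smallEtaleTopology.over T) α _ _ hg'
    rw [GrothendieckTopology.mem_over_iff] at h₁
    obtain ⟨T₂, g₂, hg₂, t₂, rfl⟩ := (Scheme.pointSmallEtale a).jointly_surjective _ h₁ t₁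
    rw [Sieve.overEquiv_iff] at hg₂
    exact congrArg ULift.down hg₂
  · intro m
    obtain ⟨T₁, t₁, z, rfl⟩ := (Scheme.pointSmallEtale a).toPresheafFiber_jointly_surjective m
    obtain ⟨T₂, t₂, g, g₁, rfl, rfl⟩ := (Scheme.pointSmallEtale a).exists_common_refinement t t₁
    have h₁ := Presheaf.imageSieve_mem (U.smallEtaleTopology.over T) α (U := op (Over.mk g))
      (F.obj.map g₁.op z)
    rw [GrothendieckTopology.mem_over_iff] at h₁
    obtain ⟨T₃, g₃, hg₃, t₃, rfl⟩ := (Scheme.pointSmallEtale a).jointly_surjective _ h₁ t₂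
    rw [Sieve.overEquiv_iff] at hg₃
    obtain ⟨c, hc⟩ := hg₃
    refine ⟨c.down, ?_⟩
    refine ((Scheme.pointSmallEtale a).toPresheafFiber_eq_of_map_eq g g₁ g₃ t₃ F.obj
      (α.app (op (Over.mk (𝟙 T))) c) z ?_)
    exact (ConcreteCategory.congr_hom (F.obj.map_comp g.op g₃.op) _).symm.trans
      ((hα (g₃ ≫ g) c).trans hc)

theorem IsTrivialization.smul_ne_zero_iff {T : U.Etale}
    {β : (Fin b → ZMod (ℓ ^ n)) →ₗ[ZMod (ℓ ^ n)] F.obj.obj (op T)} (hβ : IsTrivialization β)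
    {K : Type u} [Field K] [IsSepClosed K] {a : Spec (.of K) ⟶ U}
    (t : (Scheme.pointSmallEtale a).fiber.obj T) (m : ℕ) (c : Fin b → ZMod (ℓ ^ n)) :
    m • (Scheme.pointSmallEtale a).toPresheafFiber T t F.obj (β c) = 0 ↔ m • c = 0 := by
  have h0 : (Scheme.pointSmallEtale a).toPresheafFiber T t F.obj (β 0) = 0 := by
    rw [map_zero]
    exact map_zero ((Scheme.pointSmallEtale a).toPresheafFiber T t F.obj).hom
  have hm : m • (Scheme.pointSmallEtale a).toPresheafFiber T t F.obj (β c) =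
      (Scheme.pointSmallEtale a).toPresheafFiber T t F.obj (β (m • c)) := by
    rw [map_nsmul]
    exact (map_nsmul ((Scheme.pointSmallEtale a).toPresheafFiber T t F.obj).hom _ _).symm
  rw [hm, ← h0]
  exact (hβ K a t).1.eq_iff

/-- The section of `𝒱^*` given by a vector of `((ℤ/ℓⁿ)ᵇ)^*` and a trivialization. -/
def IsTrivialization.star {T : U.Etale}
    {β : (Fin b → ZMod (ℓ ^ n)) →ₗ[ZMod (ℓ ^ n)] F.obj.obj (op T)} (hβ : IsTrivialization β)
    (c : Fin b → ZMod (ℓ ^ n)) (hc : ℓ ^ (n - 1) • c ≠ 0) : StarSections F.obj T :=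
  ⟨β c, fun T' f ⟨x⟩ h ↦ by
    -- A nonempty `T'` has a geometric point. If `ℓ^(n-1) β c` vanished on `T'`, it would vanish in
    -- the stalk there, on which `β` is injective.
    obtain ⟨L, _, _, i, hi⟩ := exists_geometric_point x
    let t : (Scheme.pointSmallEtale (i ≫ T'.hom)).fiber.obj T' := Over.homMk i
    refine hc ((hβ.smul_ne_zero_iff ((Scheme.pointSmallEtale (i ≫ T'.hom)).fiber.map f t) _ c).mp
      ?_)
    rw [← GrothendieckTopology.Point.toPresheafFiber_w_apply]
    refine (map_nsmul ((Scheme.pointSmallEtale (i ≫ T'.hom)).toPresheafFiber T' t F.obj).hom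
      _ _).symm.trans ?_
    refine (congrArg ((Scheme.pointSmallEtale (i ≫ T'.hom)).toPresheafFiber T' t F.obj) h).trans ?_
    exact map_zero ((Scheme.pointSmallEtale (i ≫ T'.hom)).toPresheafFiber T' t F.obj).hom⟩

theorem IsTrivialization.exists_germ_eq {T : U.Etale}
    {β : (Fin b → ZMod (ℓ ^ n)) →ₗ[ZMod (ℓ ^ n)] F.obj.obj (op T)} (hβ : IsTrivialization β)
    {K : Type u} [Field K] [IsSepClosed K] {a : Spec (.of K) ⟶ U}
    (t : (Scheme.pointSmallEtale a).fiber.obj T) (m : ModStar ℓ n (etaleStalk F a)) :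
    ∃ (c : Fin b → ZMod (ℓ ^ n)) (hc : ℓ ^ (n - 1) • c ≠ 0), (hβ.star c hc).germ t = m := by
  obtain ⟨c, hc⟩ := (hβ K a t).2 m.1
  refine ⟨c, fun h ↦ m.2 ?_, Subtype.ext hc⟩
  rw [← hc]
  exact (hβ.smul_ne_zero_iff t _ c).mpr h

/-- The stalk at a geometric point of the source of a trivialization. -/
noncomputable def IsTrivialization.stalkEquiv {T : U.Etale}
    {β : (Fin b → ZMod (ℓ ^ n)) →ₗ[ZMod (ℓ ^ n)] F.obj.obj (op T)} (hβ : IsTrivialization β)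
    {K : Type u} [Field K] [IsSepClosed K] {a : Spec (.of K) ⟶ U}
    (t : (Scheme.pointSmallEtale a).fiber.obj T) :
    etaleStalk F a ≃ₗ[ZMod (ℓ ^ n)] (Fin b → ZMod (ℓ ^ n)) :=
  (LinearEquiv.ofBijective
    (((Scheme.pointSmallEtale a).toPresheafFiber T t F.obj).hom ∘ₗ β) (hβ K a t)).symm

theorem IsLocallyConstantFree.exists_isTrivialization_of_point (hF : IsLocallyConstantFree b F)
    {K : Type u} [Field K] [IsSepClosed K] (a : Spec (.of K) ⟶ U) :
    ∃ (T : U.Etale) (_ : (Scheme.pointSmallEtale a).fiber.obj T)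
      (β : (Fin b → ZMod (ℓ ^ n)) →ₗ[ZMod (ℓ ^ n)] F.obj.obj (op T)), IsTrivialization β := by
  obtain ⟨S, hS, h⟩ := hF.exists_isTrivialization
  obtain ⟨T, f, hf, t, -⟩ := (Scheme.pointSmallEtale a).jointly_surjective S hS
    (Over.homMk a (Category.comp_id a))
  obtain ⟨β, hβ⟩ := h f hf
  exact ⟨T, t, β, hβ⟩

theorem IsLocallyConstantFree.exists_stalkEquiv (hF : IsLocallyConstantFree b F)
    {K : Type u} [Field K] [IsSepClosed K] (a : Spec (.of K) ⟶ U) :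
    Nonempty (etaleStalk F a ≃ₗ[ZMod (ℓ ^ n)] (Fin b → ZMod (ℓ ^ n))) := by
  obtain ⟨T, t, β, hβ⟩ := hF.exists_isTrivialization_of_point a
  exact ⟨hβ.stalkEquiv t⟩

theorem IsLocallyConstantFree.exists_mk_germ_eq (hF : IsLocallyConstantFree b F)
    {K : Type u} [Field K] [IsSepClosed K] {a : Spec (.of K) ⟶ U}
    (m : ModProj ℓ n (etaleStalk F a)) :
    ∃ (T : U.Etale) (t : (Scheme.pointSmallEtale a).fiber.obj T) (v : StarSections F.obj T),
      ModProj.mk (v.germ t) = m := by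
  obtain ⟨T, t, β, hβ⟩ := hF.exists_isTrivialization_of_point a
  induction m using Quotient.inductionOn with | _ m =>
  obtain ⟨c, hc, h⟩ := hβ.exists_germ_eq t m
  exact ⟨T, t, hβ.star c hc, congrArg ModProj.mk h⟩

/-- Both sides are quotients of the set of triples `(T, t, v)`, through germs and through
`projPoint`, and by `projPoint_eq_iff` the two equivalence relations are the same. -/
theorem IsLocallyConstantFree.exists_equiv_fiber (hF : IsLocallyConstantFree b F) {X : U.Etale}
    (hX : (projSheaf F).obj.RepresentableBy X) {K : Type u} [Field K] [IsSepClosed K]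
    (a : Spec (.of K) ⟶ U) :
    ∃ e : ModProj ℓ n (etaleStalk F a) ≃ (Scheme.pointSmallEtale a).fiber.obj X,
      ∀ (T : U.Etale) (t : (Scheme.pointSmallEtale a).fiber.obj T) (v : StarSections F.obj T),
        e (ModProj.mk (v.germ t)) = projPoint hX t v := by
  choose T t v hv using hF.exists_mk_germ_eq (a := a)
  have key {T' : U.Etale} (t' : (Scheme.pointSmallEtale a).fiber.obj T')
      (w : StarSections F.obj T') :
      projPoint hX (t (ModProj.mk (w.germ t'))) (v (ModProj.mk (w.germ t'))) =
        projPoint hX t' w :=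
    (projPoint_eq_iff hX _ _ _ _).mpr (hv _)
  refine ⟨Equiv.ofBijective (fun m ↦ projPoint hX (t m) (v m)) ⟨fun m m' h ↦ ?_, fun x ↦ ?_⟩,
    fun T' t' w ↦ key t' w⟩
  · rw [← hv m, ← hv m']
    exact (projPoint_eq_iff hX _ _ _ _).mp h
  · obtain ⟨T', t', w, rfl⟩ := projPoint_surjective hX x
    exact ⟨_, key t' w⟩

end

namespace AlgebraicGeometry

/-! ### Universally closed morphisms and étale coverings -/

theorem Scheme.Hom.apply_apply_of_comp_eq {A B C : Scheme.{u}} {f : A ⟶ B} {g : B ⟶ C} {h : A ⟶ C}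
    (e : f ≫ g = h) (x : A) : g (f x) = h x := by
  rw [← e, Scheme.Hom.comp_apply]

theorem mem_range_lift_id {X T U Z : Scheme.{u}} {f : X ⟶ U} {p : T ⟶ U} {σ : T ⟶ X}
    (hw : σ ≫ f = 𝟙 T ≫ p) {i : Z ⟶ pullback f p}
    (h : (i ≫ pullback.snd f p) ≫ σ = i ≫ pullback.fst f p) (x : Z) :
    i x ∈ Set.range (pullback.lift σ (𝟙 T) hw) := by
  refine ⟨(i ≫ pullback.snd f p) x, Scheme.Hom.apply_apply_of_comp_eq ?_ x⟩
  refine pullback.hom_ext ?_ ?_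
  · rw [Category.assoc, pullback.lift_fst, h]
  · rw [Category.assoc, pullback.lift_snd, Category.comp_id]

/-- Needed because the disjoint union of an infinite étale cover need not be quasi-compact over the
base. -/
theorem descendsAlong_locallyOfFinitePresentation (P : MorphismProperty Scheme.{u})
    [P.DescendsAlong (@Surjective ⊓ @Flat ⊓ @QuasiCompact)] [IsZariskiLocalAtTarget P] :
    P.DescendsAlong (@Surjective ⊓ @Flat ⊓ @LocallyOfFinitePresentation) :=
  inferInstance

theorem Etale.isZariskiLocalAtSource : IsZariskiLocalAtSource (@Etale.{u}) :=
  HasRingHomProperty.instIsZariskiLocalAtSource (Q := RingHom.Etale)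

theorem Etale.locallyQuasiFinite {X Y : Scheme.{u}} (f : X ⟶ Y) [Etale f] :
    LocallyQuasiFinite f where
  quasiFinite_appLE {V} hV {W} hW e := by
    have h := Etale.etale_appLE (f := f) hV hW e
    algebraize [(f.appLE V W e).hom]
    change Algebra.QuasiFinite Γ(Y, V) Γ(X, W)
    infer_instance

/-- Universal closedness descends along the étale surjection from the disjoint union of the `T i`,
and over that union it is checked on each summand. -/
theorem universallyClosed_of_etale_cover {X U : Scheme.{u}} (f : X ⟶ U) {I : Type u}
    (T : I → Scheme.{u}) (p : ∀ i, T i ⟶ U) [∀ i, Etale (p i)]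
    (hp : ∀ y : U, ∃ i, y ∈ Set.range (p i))
    (h : ∀ i, UniversallyClosed (pullback.snd f (p i))) : UniversallyClosed f := by
  have : Etale (Sigma.desc p) := Etale.isZariskiLocalAtSource.sigmaDesc inferInstance
  have : Surjective (Sigma.desc p) := ⟨fun y ↦ by
    obtain ⟨i, x, rfl⟩ := hp y
    exact ⟨Sigma.ι T i x, by rw [← Scheme.Hom.comp_apply, Sigma.ι_desc]⟩⟩
  have := descendsAlong_locallyOfFinitePresentation @UniversallyClosed
  refine MorphismProperty.of_pullback_snd_of_descendsAlong (P := @UniversallyClosed)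
    (Q := @Surjective ⊓ @Flat ⊓ @LocallyOfFinitePresentation) (g := Sigma.desc p)
    ⟨⟨inferInstance, inferInstance⟩, inferInstance⟩ ?_
  refine IsZariskiLocalAtTarget.of_openCover (P := @UniversallyClosed) (sigmaOpenCover T)
    fun (i : I) ↦ ?_
  have hpb : IsPullback (pullback.fst (pullback.snd f (Sigma.desc p)) (Sigma.ι T i) ≫
      pullback.fst f (Sigma.desc p)) (pullback.snd (pullback.snd f (Sigma.desc p)) (Sigma.ι T i))
      f (p i) := by
    have := (IsPullback.of_hasPullback (pullback.snd f (Sigma.desc p)) (Sigma.ι T i)).flip.paste_vert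
      (IsPullback.of_hasPullback f (Sigma.desc p)).flip
    rw [Sigma.ι_desc] at this
    exact this.flip
  change UniversallyClosed (pullback.snd (pullback.snd f (Sigma.desc p)) (Sigma.ι T i))
  rw [← hpb.isoPullback_hom_snd]
  have := h i
  infer_instance

/-- A quasi-compact étale morphism that has a section through each point is universally closed. -/
theorem universallyClosed_of_forall_exists_section {P T : Scheme.{u}} (g : P ⟶ T) [Etale g]
    [QuasiCompact g] (h : ∀ x : P, ∃ σ : T ⟶ P, σ ≫ g = 𝟙 T ∧ x ∈ Set.range σ) :
    UniversallyClosed g := by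
  refine UniversallyClosed.of_valuativeCriterion g fun S ↦ ?_
  obtain ⟨σ, hσ, t, ht⟩ := h (S.i₁ default)
  have := isOpenImmersion_of_section hσ
  have hr : Set.range S.i₁ ⊆ Set.range σ := by
    rintro _ ⟨z, rfl⟩
    exact ⟨t, by rw [ht, Subsingleton.elim z default]⟩
  have hl := IsOpenImmersion.lift_fac σ S.i₁ hr
  have hl' : IsOpenImmersion.lift σ S.i₁ hr = S.i₁ ≫ g := by
    conv_rhs => rw [← hl, Category.assoc, hσ, Category.comp_id]
  -- The given field-valued point factors through the open immersion `σ`, so it equals `S.i₁ ≫ g ≫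
  -- σ`. Following the valuation ring point of `T` by `σ` therefore gives the lift.
  refine ⟨⟨⟨S.i₂ ≫ σ, ?_, ?_⟩⟩⟩
  · rw [← reassoc_of% S.commSq.w, ← reassoc_of% hl', hl]
  · rw [Category.assoc, hσ, Category.comp_id]

end AlgebraicGeometry

/-! ### Finiteness of the representing schemes -/

section

variable {U : Scheme.{u}} {ℓ n b : ℕ}
  {F : Sheaf U.smallEtaleTopology (ModuleCat.{u} (ZMod (ℓ ^ n)))}
  {X : U.Etale}

/-- A geometric point of the pullback is a class in a stalk. The trivialization extends it to a
section of `𝒱^*` over all of `T`, hence to a section of the projection through that point. -/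
theorem IsTrivialization.universallyClosed_pullback_snd (hX : (projSheaf F).obj.RepresentableBy X)
    [QuasiCompact X.hom] {T : U.Etale}
    {β : (Fin b → ZMod (ℓ ^ n)) →ₗ[ZMod (ℓ ^ n)] F.obj.obj (op T)} (hβ : IsTrivialization β) :
    UniversallyClosed (pullback.snd X.hom T.hom) := by
  refine universallyClosed_of_forall_exists_section _ fun x ↦ ?_
  obtain ⟨L, _, _, i, rfl⟩ := exists_geometric_point x
  let t : (Scheme.pointSmallEtale (i ≫ pullback.snd X.hom T.hom ≫ T.hom)).fiber.obj T :=
    Over.homMk (i ≫ pullback.snd X.hom T.hom) (Category.assoc _ _ _)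
  let z : (Scheme.pointSmallEtale (i ≫ pullback.snd X.hom T.hom ≫ T.hom)).fiber.obj X :=
    Over.homMk (i ≫ pullback.fst X.hom T.hom) (by
      rw [← pullback.condition]; exact Category.assoc _ _ _)
  obtain ⟨T', t', v, hv⟩ := projPoint_surjective hX z
  obtain ⟨c, hc, hcv⟩ := hβ.exists_germ_eq t (v.germ t')
  have h : projPoint hX t (hβ.star c hc) = z := by
    rw [← hv, projPoint_eq_iff, hcv]
  let σ : T ⟶ X := hX.homEquiv.symm (projClass F (hβ.star c hc))
  have hσ : t.left ≫ σ.left = i ≫ pullback.fst X.hom T.hom := congrArg (fun y ↦ y.left) h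
  have hw : σ.left ≫ X.hom = 𝟙 _ ≫ T.hom := by
    rw [Category.id_comp]; exact MorphismProperty.Over.w σ
  exact ⟨pullback.lift σ.left (𝟙 _) hw, pullback.lift_snd _ _ _, mem_range_lift_id hw hσ _⟩

theorem IsLocallyConstantFree.universallyClosed (hF : IsLocallyConstantFree b F)
    (hX : (projSheaf F).obj.RepresentableBy X) [QuasiCompact X.hom] :
    UniversallyClosed X.hom := by
  have h (y : U) : ∃ (T : U.Etale) (_ : y ∈ Set.range T.hom)
      (β : (Fin b → ZMod (ℓ ^ n)) →ₗ[ZMod (ℓ ^ n)] F.obj.obj (op T)), IsTrivialization β := by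
    obtain ⟨L, _, _, a, rfl⟩ := exists_geometric_point y
    obtain ⟨T, t, β, hβ⟩ := hF.exists_isTrivialization_of_point a
    refine ⟨T, ⟨t.left (default : Spec (.of L)), ?_⟩, β, hβ⟩
    exact Scheme.Hom.apply_apply_of_comp_eq (Over.w t) (default : Spec (.of L))
  choose T hT β hβ using h
  exact universallyClosed_of_etale_cover X.hom (fun y ↦ (T y).left) (fun y ↦ (T y).hom)
    (fun y ↦ ⟨y, hT y⟩) fun y ↦ (hβ y).universallyClosed_pullback_snd hX

/-- Étale morphisms are locally quasi-finite, and a proper, locally quasi-finite morphism is finite.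
-/
theorem IsLocallyConstantFree.isFinite (hF : IsLocallyConstantFree b F)
    (hX : (projSheaf F).obj.RepresentableBy X) [QuasiCompact X.hom] [IsSeparated X.hom] :
    IsFinite X.hom := by
  have := hF.universallyClosed hX
  have : IsProper X.hom := {}
  have := Etale.locallyQuasiFinite X.hom
  exact IsFinite.of_isProper_of_locallyQuasiFinite X.hom

end

/-! ### Transition maps on stalks -/

section

variable {U : Scheme.{u}} {ℓ m n b : ℕ}
  {F : Sheaf U.smallEtaleTopology (ModuleCat.{u} (ZMod (ℓ ^ m)))}
  {G : Sheaf U.smallEtaleTopology (ModuleCat.{u} (ZMod (ℓ ^ n)))}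

/-- The two sheaves have different coefficient rings, so the additive map on stalks is built from
representatives of germs. -/
theorem AbHom.exists_stalkMap (φ : AbHom F G) {K : Type u} [Field K] [IsSepClosed K]
    (a : Spec (.of K) ⟶ U) :
    ∃ ψ : etaleStalk F a →+ etaleStalk G a,
      ∀ (T : U.Etale) (t : (Scheme.pointSmallEtale a).fiber.obj T) (v : F.obj.obj (op T)),
        ψ ((Scheme.pointSmallEtale a).toPresheafFiber T t F.obj v) =
          (Scheme.pointSmallEtale a).toPresheafFiber T t G.obj (φ.onSections T v) := by
  have hres {T T' : U.Etale} (f : T' ⟶ T) (t : (Scheme.pointSmallEtale a).fiber.obj T')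
      (v : F.obj.obj (op T)) :
      (Scheme.pointSmallEtale a).toPresheafFiber T' t G.obj (φ.onSections T' (F.obj.map f.op v)) =
        (Scheme.pointSmallEtale a).toPresheafFiber T ((Scheme.pointSmallEtale a).fiber.map f t)
          G.obj (φ.onSections T v) := by
    rw [φ.naturality_apply]
    exact (Scheme.pointSmallEtale a).toPresheafFiber_w_apply f t G.obj _
  have hwd {T T' : U.Etale} (t : (Scheme.pointSmallEtale a).fiber.obj T)
      (t' : (Scheme.pointSmallEtale a).fiber.obj T') (v : F.obj.obj (op T))
      (v' : F.obj.obj (op T'))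
      (h : (Scheme.pointSmallEtale a).toPresheafFiber T t F.obj v =
        (Scheme.pointSmallEtale a).toPresheafFiber T' t' F.obj v') :
      (Scheme.pointSmallEtale a).toPresheafFiber T t G.obj (φ.onSections T v) =
        (Scheme.pointSmallEtale a).toPresheafFiber T' t' G.obj (φ.onSections T' v') := by
    obtain ⟨T₁, t₁, f, g, rfl, rfl⟩ := (Scheme.pointSmallEtale a).exists_common_refinement t t'
    rw [← GrothendieckTopology.Point.toPresheafFiber_w_apply,
      ← GrothendieckTopology.Point.toPresheafFiber_w_apply,
      GrothendieckTopology.Point.toPresheafFiber_eq_iff'] at h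
    obtain ⟨T₂, g₂, t₂, rfl, h⟩ := h
    rw [← hres, ← hres, ← hres, ← hres, h]
  choose T t v hv using
    (Scheme.pointSmallEtale a).toPresheafFiber_jointly_surjective (P := F.obj)
  refine ⟨{ toFun x := (Scheme.pointSmallEtale a).toPresheafFiber (T x) (t x) G.obj
              (φ.onSections (T x) (v x))
            map_zero' := ?_
            map_add' x y := ?_ }, fun T' t' v' ↦ hwd _ _ _ _ (hv _)⟩
  · refine (hwd _ (t 0) _ 0 ((hv 0).trans
      (map_zero ((Scheme.pointSmallEtale a).toPresheafFiber _ _ F.obj).hom).symm)).trans ?_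
    rw [map_zero]
    exact map_zero ((Scheme.pointSmallEtale a).toPresheafFiber _ _ G.obj).hom
  · obtain ⟨T', t', v₁, v₂, h₁, h₂⟩ :=
      (Scheme.pointSmallEtale a).toPresheafFiber_jointly_surjective₂ (P := F.obj) x y
    refine (hwd _ t' _ (v₁ + v₂) ((hv _).trans ?_)).trans ?_
    · rw [← h₁, ← h₂]
      exact (map_add ((Scheme.pointSmallEtale a).toPresheafFiber _ _ F.obj).hom _ _).symm
    · rw [hwd _ t' _ v₁ ((hv x).trans h₁.symm), hwd _ t' _ v₂ ((hv y).trans h₂.symm), map_add]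
      exact map_add ((Scheme.pointSmallEtale a).toPresheafFiber _ _ G.obj).hom _ _

theorem AbHom.KerKilled.stalkMap {φ : AbHom F G} (hφ : φ.KerKilled) {K : Type u} [Field K]
    [IsSepClosed K] {a : Spec (.of K) ⟶ U} {ψ : etaleStalk F a →+ etaleStalk G a}
    (hψ : ∀ (T : U.Etale) (t : (Scheme.pointSmallEtale a).fiber.obj T) (v : F.obj.obj (op T)),
        ψ ((Scheme.pointSmallEtale a).toPresheafFiber T t F.obj v) =
          (Scheme.pointSmallEtale a).toPresheafFiber T t G.obj (φ.onSections T v))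
    (x : etaleStalk F a) (hx : ψ x = 0) : ℓ • x = 0 := by
  obtain ⟨T, t, v, rfl⟩ :=
    (Scheme.pointSmallEtale a).toPresheafFiber_jointly_surjective (P := F.obj) x
  rw [hψ] at hx
  obtain ⟨T₁, f, t₁, rfl, h⟩ := ((Scheme.pointSmallEtale a).toPresheafFiber_eq_iff' _ _ _ _).mp
    (hx.trans (map_zero ((Scheme.pointSmallEtale a).toPresheafFiber T t G.obj).hom).symm)
  have h' : φ.onSections T₁ (F.obj.map f.op v) = 0 :=
    (φ.naturality_apply f v).trans (h.trans (map_zero (G.obj.map f.op).hom))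
  have h₂ := hφ T₁ _ h'
  rw [← GrothendieckTopology.Point.toPresheafFiber_w_apply]
  refine (map_nsmul ((Scheme.pointSmallEtale a).toPresheafFiber T₁ t₁ F.obj).hom _ _).symm.trans ?_
  exact (congrArg ((Scheme.pointSmallEtale a).toPresheafFiber T₁ t₁ F.obj) h₂).trans
    (map_zero ((Scheme.pointSmallEtale a).toPresheafFiber T₁ t₁ F.obj).hom)

variable {X Y : U.Etale} (hX : (projSheaf F).obj.RepresentableBy X)
  (hY : (projSheaf G).obj.RepresentableBy Y)

theorem projSheafMap_projClass (φ : AbHom F G) (hφ : φ.KerKilled) (hn : 1 ≤ n) (hm : m = n + 1)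
    {T : U.Etale} (v : StarSections F.obj T) :
    (projSheafMap φ hφ hn hm).hom.app (op T) (projClass F v) =
      projClass G (StarSections.map φ hφ hn hm v) :=
  (ConcreteCategory.congr_hom (NatTrans.congr_app
    (toSheafify_naturality U.smallEtaleTopology (projPresheafMap φ hφ hn hm)) (op T))
    (Quotient.mk (MulAction.orbitRel (ZMod (ℓ ^ m))ˣ (StarSections F.obj T)) v)).symm

theorem comp_representedMap {P Q : Sheaf U.smallEtaleTopology (Type u)}
    (hP : P.obj.RepresentableBy X) (hQ : Q.obj.RepresentableBy Y) (ψ : P ⟶ Q) {T : U.Etale}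
    (x : P.obj.obj (op T)) :
    hP.homEquiv.symm x ≫ representedMap hP hQ ψ = hQ.homEquiv.symm (ψ.hom.app (op T) x) := by
  rw [representedMap, hQ.comp_homEquiv_symm]
  congr 1
  rw [← NatTrans.naturality_apply, ← hP.homEquiv_comp, Category.comp_id,
    Equiv.apply_symm_apply]

theorem map_representedMap_projPoint (φ : AbHom F G) (hφ : φ.KerKilled) (hn : 1 ≤ n)
    (hm : m = n + 1) {K : Type u} [Field K] [IsSepClosed K] {a : Spec (.of K) ⟶ U}
    {T : U.Etale} (t : (Scheme.pointSmallEtale a).fiber.obj T) (v : StarSections F.obj T) :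
    (Scheme.pointSmallEtale a).fiber.map (representedMap hX hY (projSheafMap φ hφ hn hm))
      (projPoint hX t v) = projPoint hY t (StarSections.map φ hφ hn hm v) := by
  have h : hX.homEquiv.symm (projClass F v) ≫ representedMap hX hY (projSheafMap φ hφ hn hm) =
      hY.homEquiv.symm (projClass G (StarSections.map φ hφ hn hm v)) :=
    (comp_representedMap hX hY _ _).trans
      (congrArg hY.homEquiv.symm (projSheafMap_projClass φ hφ hn hm v))
  rw [projPoint, projPoint, ← h]
  exact (ConcreteCategory.congr_hom ((Scheme.pointSmallEtale a).fiber.map_comp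
    (hX.homEquiv.symm (projClass F v)) (representedMap hX hY (projSheafMap φ hφ hn hm))) t).symm

/-- Under the identification of fibres with projectivised stalks, the represented morphism becomes
`ModProj.map` of the map on stalks. The product form avoids the exponent `b - 1`, which truncates
for `b = 0`. -/
theorem natCard_fiber_representedMap [Fact ℓ.Prime] (hF : IsLocallyConstantFree b F)
    (hG : IsLocallyConstantFree b G) (φ : AbHom F G) (hφ : φ.KerKilled) (hn : 1 ≤ n)
    (hm : m = n + 1) {K : Type u} [Field K] [IsSepClosed K] {a : Spec (.of K) ⟶ U}
    (y : (Scheme.pointSmallEtale a).fiber.obj Y) :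
    Nat.card {x : (Scheme.pointSmallEtale a).fiber.obj X // (Scheme.pointSmallEtale a).fiber.map
      (representedMap hX hY (projSheafMap φ hφ hn hm)) x = y} * ℓ = ℓ ^ b := by
  obtain ⟨ψ, hψ⟩ := φ.exists_stalkMap a
  obtain ⟨eX, heX⟩ := hF.exists_equiv_fiber hX a
  obtain ⟨eY, heY⟩ := hG.exists_equiv_fiber hY a
  obtain ⟨eF⟩ := hF.exists_stalkEquiv a
  obtain ⟨eG⟩ := hG.exists_stalkEquiv a
  have h := ModProj.natCard_fiber_map eF eG ψ (hφ.stalkMap hψ) hn hm (eY.symm y)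
  rw [← h]
  congr 1
  refine (Nat.card_congr (eX.subtypeEquiv fun q ↦ ?_)).symm
  rw [Equiv.eq_symm_apply]
  obtain ⟨T, t, v, rfl⟩ := hF.exists_mk_germ_eq q
  rw [heX, map_representedMap_projPoint, ← heY]
  have : ModProj.map ψ (hφ.stalkMap hψ) hn hm (ModProj.mk (v.germ t)) =
      ModProj.mk ((StarSections.map φ hφ hn hm v).germ t) :=
    congrArg ModProj.mk (Subtype.ext (hψ T t v.1))
  rw [this]

/-- The points of a fiber, as points of an étale scheme over another étale scheme. -/
noncomputable def fiberSubtypeEquivLifts {X Y : U.Etale} (f : X ⟶ Y) {K : Type u} [Field K] [IsSepClosed K]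
    (y : Spec (.of K) ⟶ Y.left) :
    {x : (Scheme.pointSmallEtale (y ≫ Y.hom)).fiber.obj X //
      (Scheme.pointSmallEtale (y ≫ Y.hom)).fiber.map f x = Over.homMk y} ≃
        {x : Spec (.of K) ⟶ X.left // x ≫ f.left = y} where
  toFun x := ⟨x.1.left, congrArg (fun z ↦ z.left) x.2⟩
  invFun x := ⟨Over.homMk x.1 (by
    have : f.left ≫ Y.hom = X.hom := MorphismProperty.Over.w f
    change x.1 ≫ X.hom = y ≫ Y.hom
    rw [← this, reassoc_of% x.2]), Over.OverMorphism.ext x.2⟩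
  left_inv _ := rfl
  right_inv _ := rfl

end

/-! ### Degrees of the representing schemes -/

section

variable {U : Scheme.{u}} {ℓ m n b : ℕ}
  {F : Sheaf U.smallEtaleTopology (ModuleCat.{u} (ZMod (ℓ ^ m)))}
  {G : Sheaf U.smallEtaleTopology (ModuleCat.{u} (ZMod (ℓ ^ n)))}

/-- The points of a fiber, as points of an étale scheme. -/
noncomputable def fiberEquivLifts (X : U.Etale) {K : Type u} [Field K] [IsSepClosed K]
    (a : Spec (.of K) ⟶ U) :
    (Scheme.pointSmallEtale a).fiber.obj X ≃ {x : Spec (.of K) ⟶ X.left // x ≫ X.hom = a} where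
  toFun x := ⟨x.left, Over.w x⟩
  invFun x := Over.homMk x.1 x.2
  left_inv _ := rfl
  right_inv _ := rfl

variable {X Y : U.Etale}

theorem IsLocallyConstantFree.finrank_hom [Fact ℓ.Prime] {F : Sheaf U.smallEtaleTopology
    (ModuleCat.{u} (ZMod (ℓ ^ 1)))} (hF : IsLocallyConstantFree b F)
    (hX : (projSheaf F).obj.RepresentableBy X) [IsFinite X.hom] (y : U) :
    X.hom.finrank y * (ℓ - 1) = ℓ ^ b - 1 := by
  obtain ⟨L, _, _, a, rfl⟩ := exists_geometric_point y
  obtain ⟨e, -⟩ := hF.exists_equiv_fiber hX a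
  obtain ⟨e'⟩ := hF.exists_stalkEquiv a
  rw [← natCard_lifts_eq_finrank]
  refine Eq.trans ?_ (ModProj.natCard_one e')
  exact congrArg (· * (ℓ - 1)) (Nat.card_congr (e.trans (fiberEquivLifts X a))).symm

theorem finrank_representedMap [Fact ℓ.Prime] (hF : IsLocallyConstantFree b F)
    (hG : IsLocallyConstantFree b G) (hX : (projSheaf F).obj.RepresentableBy X)
    (hY : (projSheaf G).obj.RepresentableBy Y) (φ : AbHom F G) (hφ : φ.KerKilled) (hn : 1 ≤ n)
    (hm : m = n + 1) [IsFinite (representedMap hX hY (projSheafMap φ hφ hn hm)).left] (y : Y.left) :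
    (representedMap hX hY (projSheafMap φ hφ hn hm)).left.finrank y * ℓ = ℓ ^ b := by
  obtain ⟨L, _, _, a, rfl⟩ := exists_geometric_point y
  rw [← natCard_lifts_eq_finrank, ← Nat.card_congr (fiberSubtypeEquivLifts _ a)]
  exact natCard_fiber_representedMap hX hY hF hG φ hφ hn hm _

end

/-! ### Geometric fibers of compactifications -/

namespace RegularCompactification

variable {k : Type u} [Field k] {X Y : Scheme.{u}} {sX : X ⟶ Spec (.of k)} {sY : Y ⟶ Spec (.of k)}

/-- A representing étale scheme is not assumed separated or quasi-compact over `U`. Both properties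
come from its open immersion into a proper `k`-scheme, which is separated and noetherian. -/
theorem isSeparated_of_comp {f : X ⟶ Y} (CX : RegularCompactification (f ≫ sY)) :
    IsSeparated f := by
  have := CX.isProper
  have := CX.isOpenImmersion
  have : IsSeparated (f ≫ sY) := CX.ι_str ▸ inferInstance
  exact .of_comp f sY

theorem quasiCompact_of_comp {f : X ⟶ Y} [IsSeparated sY] (CX : RegularCompactification (f ≫ sY)) :
    QuasiCompact f := by
  have := CX.isProper
  have := CX.isOpenImmersion
  have := CX.isNoetherian
  have : QuasiCompact CX.ι := inferInstance
  have : QuasiCompact (f ≫ sY) := CX.ι_str ▸ inferInstance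
  exact .of_comp f sY

section

variable {CX : RegularCompactification sX} {CY : RegularCompactification sY} {f : X ⟶ Y}
  {F : CX.C ⟶ CY.C} {K : Type u} [Field K] (h : IsPullback CX.ι f F CY.ι) (a : Spec (.of K) ⟶ Y)

/-- The points of a compactification over a point of the base. -/
noncomputable def liftsEquiv : {x : Spec (.of K) ⟶ X // x ≫ f = a} ≃
    {x : Spec (.of K) ⟶ CX.C // x ≫ F = a ≫ CY.ι} where
  toFun x := ⟨x.1 ≫ CX.ι, by rw [Category.assoc, h.w, reassoc_of% x.2]⟩
  invFun x := ⟨h.lift x.1 a x.2, h.lift_snd _ _ _⟩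
  left_inv x := Subtype.ext (h.hom_ext (h.lift_fst _ _ _) ((h.lift_snd _ _ _).trans x.2.symm))
  right_inv x := Subtype.ext (h.lift_fst _ _ _)

include h in
-- By the cartesian square, the fibre of `F` over a point of `Y` is the fibre of `f`. It is étale
-- over `K`, hence the disjoint union of its sections.
theorem isIso_sigmaDesc_lift [IsSepClosed K] [Etale f] {I : Type u}
    (e : I ≃ {x : Spec (.of K) ⟶ CX.C // x ≫ F = a ≫ CY.ι}) :
    IsIso (Sigma.desc fun i ↦ pullback.lift (f := F) (g := a ≫ CY.ι) (e i).1
      (𝟙 (Spec (.of K))) (by rw [(e i).2, Category.id_comp])) := by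
  have hp := (IsPullback.of_hasPullback f a).flip.paste_vert h.flip
  have : Etale (pullback.snd F (a ≫ CY.ι)) := by
    rw [← hp.flip.isoPullback_inv_snd]
    infer_instance
  refine isIso_sigmaDesc_sections (p := pullback.snd F (a ≫ CY.ι))
    (fun i ↦ pullback.lift_snd _ _ _) (fun i j hij ↦ ?_) fun τ hτ ↦ ?_
  · refine e.injective (Subtype.ext ?_)
    exact (pullback.lift_fst _ _ _).symm.trans
      ((congrArg (· ≫ pullback.fst F (a ≫ CY.ι)) hij).trans (pullback.lift_fst _ _ _))
  · refine ⟨e.symm ⟨τ ≫ pullback.fst F (a ≫ CY.ι), ?_⟩, ?_⟩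
    · rw [Category.assoc, pullback.condition, reassoc_of% hτ]
    · refine pullback.hom_ext ?_ ?_
      · rw [pullback.lift_fst, Equiv.apply_symm_apply]
      · rw [pullback.lift_snd, hτ]

end

end RegularCompactification

/-! ### The main theorem -/

theorem mainTheorem7 {k : Type u} [Field k] (p : ℕ) [Fact p.Prime] [CharP k p]
    (K : Type u) [Field K] [Algebra k K] [IsAlgClosed K] [Algebra.IsAlgebraic k K]
    (ℓ : ℕ) [Fact ℓ.Prime] (hℓp : ℓ ≠ p) (b : ℕ)
    (U : Scheme.{u}) (s : U ⟶ Spec (.of k))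
    [SmoothOfRelativeDimension 1 s] [IsSeparated s] [QuasiCompact s]
    (𝒱 : ProjSystem U ℓ b)
    (X : ℕ+ → U.Etale) (hX : ∀ n, (projSheaf (𝒱.V n)).obj.RepresentableBy (X n))
    (C₀ : RegularCompactification s)
    (C : ∀ n : ℕ+, RegularCompactification ((X n).hom ≫ s)) :
    ∃ (π : ∀ n : ℕ+, (C n).C ⟶ C₀.C) (ρ : ∀ n : ℕ+, (C (n + 1)).C ⟶ (C n).C),
      -- `C_n → C_0` is the unique extension of `U_n → U`
      (∀ n, (C n).ι ≫ π n = (X n).hom ≫ C₀.ι ∧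
        ∀ q : (C n).C ⟶ C₀.C, (C n).ι ≫ q = (X n).hom ≫ C₀.ι → q = π n) ∧
      -- `C_{n+1} → C_n` is the unique extension of the morphism `U_{n+1} → U_n` given by `𝒱.φ n`
      (∀ n,
        let f : X (n + 1) ⟶ X n := representedMap (hX (n + 1)) (hX n)
          (projSheafMap (𝒱.φ n) (𝒱.kerKilled n) n.pos rfl)
        (C (n + 1)).ι ≫ ρ n = f.left ≫ (C n).ι ∧
        ∀ q : (C (n + 1)).C ⟶ (C n).C, (C (n + 1)).ι ≫ q = f.left ≫ (C n).ι → q = ρ n) ∧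
      -- the geometric fiber of `C_n` over `a ∈ U(K)` is `P_n((𝒱_n)_a)`: on `K`-points through the
      -- map that sends `[v_t]` to the image of `t` under the morphism `T → U_n` given by `[v]`, for
      -- an étale neighbourhood `(T, t)` of `a` and `v ∈ 𝒱_n^*(T)`; and as a scheme over `K`
      (∀ (n : ℕ+) (a : Spec (.of K) ⟶ U),
        a ≫ s = Spec.map (CommRingCat.ofHom (algebraMap k K)) →
        ∃ e : ModProj ℓ n (etaleStalk (𝒱.V n) a) ≃
            {x : Spec (.of K) ⟶ (C n).C // x ≫ π n = a ≫ C₀.ι},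
          (∀ (T : U.Etale) (t : (Scheme.pointSmallEtale a).fiber.obj T)
            (v : StarSections (𝒱.V n).obj T),
            (e (ModProj.mk (v.germ t))).1 =
              t.left ≫ ((hX n).homEquiv.symm (projClass (𝒱.V n) v)).left ≫ (C n).ι) ∧
          IsIso (Sigma.desc fun m ↦ pullback.lift (f := π n) (g := a ≫ C₀.ι) (e m).1
            (𝟙 (Spec (.of K))) (by rw [(e m).2, Category.id_comp]))) ∧
      -- degrees
      IsFiniteOfDegree (π 1) (((ℓ : ℚ) ^ b - 1) / ((ℓ : ℚ) - 1)) ∧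
      (∀ n, IsFiniteOfDegree (ρ n) ((ℓ : ℚ) ^ ((b : ℤ) - 1))) := by
  have hℓ : 1 < ℓ := (Fact.out : ℓ.Prime).one_lt
  have hsep (n : ℕ+) : IsSeparated (X n).hom := (C n).isSeparated_of_comp
  have hqc (n : ℕ+) : QuasiCompact (X n).hom := (C n).quasiCompact_of_comp
  have hfin (n : ℕ+) : IsFinite (X n).hom := (𝒱.locallyConstantFree n).isFinite (hX n)
  -- Étale means smooth of relative dimension `0`, and relative dimensions add under composition.
  have hsm (n : ℕ+) : SmoothOfRelativeDimension 1 ((X n).hom ≫ s) :=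
    inferInstanceAs (SmoothOfRelativeDimension (0 + 1) ((X n).hom ≫ s))
  let f (n : ℕ+) : X (n + 1) ⟶ X n := representedMap (hX (n + 1)) (hX n)
    (projSheafMap (𝒱.φ n) (𝒱.kerKilled n) n.pos rfl)
  have hf (n : ℕ+) : (f n).left ≫ (X n).hom = (X (n + 1)).hom := MorphismProperty.Over.w (f n)
  have hfs (n : ℕ+) : (f n).left ≫ (X n).hom ≫ s = (X (n + 1)).hom ≫ s := by
    rw [reassoc_of% hf n]
  have hffin (n : ℕ+) : IsFinite (f n).left := by
    have : IsFinite ((f n).left ≫ (X n).hom) := by rw [hf]; infer_instance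
    exact .of_comp (f n).left (X n).hom
  have hfet (n : ℕ+) : Etale (f n).left := inferInstance
  choose π hπ using fun n ↦ (C n).exists_extension C₀ (X n).hom rfl
  choose ρ hρ using fun n ↦ (C (n + 1)).exists_extension (C n) (f n).left (hfs n)
  have := C₀.isSeparated
  have (n : ℕ+) := (C n).isSeparated
  refine ⟨π, ρ, fun n ↦ ⟨hπ n, fun q hq ↦ (C n).hom_ext (hq.trans (hπ n).symm)⟩,
    fun n ↦ ⟨hρ n, fun q hq ↦ (C (n + 1)).hom_ext (hq.trans (hρ n).symm)⟩,
    fun n a _ ↦ ?_, ?_, fun n ↦ ?_⟩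
  · obtain ⟨e, he⟩ := (𝒱.locallyConstantFree n).exists_equiv_fiber (hX n) a
    have hp := (C n).isPullback_extension C₀ (X n).hom rfl (hπ n)
    refine ⟨(e.trans (fiberEquivLifts (X n) a)).trans
      (RegularCompactification.liftsEquiv hp a), fun T t v ↦ ?_,
      RegularCompactification.isIso_sigmaDesc_lift hp a _⟩
    change (e (ModProj.mk (v.germ t))).left ≫ (C n).ι = _
    rw [he]
    exact Category.assoc _ _ _
  · refine (C 1).isFiniteOfDegree_extension C₀ (X 1).hom rfl (hπ 1) fun y ↦ ?_
    have h : (X 1).hom.finrank y * (ℓ - 1) = ℓ ^ b - 1 :=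
      (𝒱.locallyConstantFree 1).finrank_hom (F := 𝒱.V 1) (hX 1) y
    rw [eq_div_iff (sub_ne_zero.mpr (by exact_mod_cast hℓ.ne'))]
    have h' := congrArg (Nat.cast (R := ℚ)) h
    rwa [Nat.cast_mul, Nat.cast_sub hℓ.le, Nat.cast_sub (Nat.one_le_pow _ _ (by omega)),
      Nat.cast_pow, Nat.cast_one] at h'
  · refine (C (n + 1)).isFiniteOfDegree_extension (C n) (f n).left (hfs n) (hρ n) fun y ↦ ?_
    have h : (f n).left.finrank y * ℓ = ℓ ^ b := finrank_representedMap
      (𝒱.locallyConstantFree (n + 1)) (𝒱.locallyConstantFree n) _ _ _ _ _ _ y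
    have hℓ' : (ℓ : ℚ) ≠ 0 := by exact_mod_cast (zero_lt_one.trans hℓ).ne'
    -- The exponent is an integer, so dividing by `ℓ` is legitimate for `b = 0` too; in that case
    -- the equation in `h` has no solution, and there is no point `y`.
    rw [zpow_sub_one₀ hℓ', zpow_natCast, ← div_eq_mul_inv, eq_div_iff hℓ']
    exact_mod_cast h
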